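/- **Setting.** Let $\mathcal O$ be a compact connected oriented 2-orbifold, possibly with boundary, whose only singularities are cone points, with underlying surface $X_{\mathcal O}$, cone points of orders $r_1,\dots,r_c\ge 2$ and negative orbifold Euler characteristic $\chi(\mathcal O)=\chi(X_{\mathcal O})-\sum_j(1-1/r_j)<0$. Let $\xi_1,\dots,\xi_m$ be pairwise disjoint curves in the interior of $\mathcal O$, each of which is either an essential simple closed curve (a simple closed curve avoiding the cone points that, in $X_{\mathcal O}$ minus the cone points, is not homotopic to a point, a boundary component or a puncture) or a full 1-suborbifold (an embedded arc joining two distinct cone points of order $2$ and otherwise avoiding the cone points). Let $\mathcal O_1,\dots,\mathcal O_l$ be the completions of the connected components of $\mathcal O\setminus\bigcup_i\xi_i$, and suppose that $\chi(\mathcal O_i)<0$ for all $i$. Put $\Gamma=\pi_1^{\rm orb}(\mathcal O)$, $\Gamma_i=\pi_1^{\rm orb}(\mathcal O_i)$, and let $\iota_i:\Gamma_i\to\Gamma$ be induced by the inclusion, after a choice of base points and of paths joining them. Write $z_1,\dots,z_b\in\Gamma$ for the boundary components of $\mathcal O$ (with the boundary orientation, joined to the base point by paths), $\partial\Gamma=\{\langle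 z_1\rangle,\dots,\langle z_b\rangle\}$, and $\mathcal S=\partial\Gamma\cup\{\langle\xi_1\rangle,\dots,\langle\xi_m\rangle\}$, where for a full 1-suborbifold $\langle\xi_i\rangle$ means $\langle s_1s_2\rangle$, with $s_1,s_2$ the order-two elements of $\Gamma$ fixing the two end points of a lift of $\xi_i$ to the universal cover. For a group $G$, a family $\mathcal T$ of subgroups and a $G$-module $M$, the parabolic cohomology $H^1_{\rm par}(G,\mathcal T;M)$ is the image of the relative cohomology $H^1(G,\mathcal T;M)$ of the group pair in $H^1(G;M)$. For a family $\mathscr B$ of conjugacy classes of $\mathrm{PSL}_n(\mathbb R)$, one for each boundary component, let $\mathrm{Hom}_s^{\mathscr B}(\Gamma,\mathrm{PSL}_n(\mathbb R))$ be the set of irreducible $\rho:\Gamma\to\mathrm{PSL}_n(\mathbb R)$ with trivial centralizer and $\rho(z_j)\in B_j$ for all $j$, and $\mathcal X_n^{\mathscr B}(\Gamma)$ its quotient by conjugation. Given $\rho$ in it, $\Gamma$ acts on $\mathfrak g=\mathfrak{sl}_n(\mathbb R)$ by $\mathrm{Ad}\circ\rho$. The Atiyah–Bott–Goldman form $\omega^{\mathcal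 O}$ on $H^1_{\rm par}(\Gamma,\partial\Gamma;\mathfrak g)$ is the cup product, formed with $\mathrm{Tr}(XY)$, evaluated on the relative fundamental class: if $\mathfrak c$ is the fundamental chain of $\mathcal O$ in the real bar complex of $\Gamma$ (so $\partial\mathfrak c=\sum_j[z_j]$) and $u,v$ are parabolic cocycles with $u(z_j)=z_j\cdot X_j-X_j$, then $$\omega^{\mathcal O}([u],[v])=\langle u\cup v,\mathfrak c\rangle-\sum_j\mathrm{Tr}(X_j\,v(z_j)),\qquad (u\cup v)[a|b]=\mathrm{Tr}\bigl(u(a)\;a\cdot v(b)\bigr).$$ The forms $\omega^{\mathcal O_i}$ are defined in the same way for $\Gamma_i$, $\partial\Gamma_i$ and $\rho\circ\iota_i$. **Theorem.** Let $[\rho]\in\mathcal X_n^{\mathscr B}(\Gamma)$ be such that for each $i$ one has $[\rho\circ\iota_i]\in\mathcal X_n^{\mathscr B_i}(\Gamma_i)$ for some family $\mathscr B_i$ of conjugacy classes. Then $\iota_i^*$ maps $H^1_{\rm par}(\Gamma,\mathcal S;\mathfrak g)$ into $H^1_{\rm par}(\Gamma_i,\partial\Gamma_i;\mathfrak g)$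 for every $i$, and for all $[u],[v]\in H^1_{\rm par}(\Gamma,\mathcal S;\mathfrak g)\subseteq H^1_{\rm par}(\Gamma,\partial\Gamma;\mathfrak g)$ $$\omega^{\mathcal O}([u],[v])=\sum_{i=1}^{l}\omega^{\mathcal O_i}(\iota_i^*[u],\iota_i^*[v]).$$ -/

import Mathlib

/-! Compact oriented cone 2-orbifolds are described by oriented polygons that are glued along some
of their sides. Every compact oriented surface with boundary is obtained in this way, the cone
points can be taken to be vertices, and finitely many disjoint curves can be taken to run along
the sides. -/

open CategoryTheory

/-- Summing over the orbits of a permutation is summing over all points. -/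
theorem sum_orbits {D M : Type*} [Fintype D] [AddCommMonoid M] (σ : Equiv.Perm D) (g : D → M)
    [Fintype (_root_.Quotient (Equiv.Perm.SameCycle.setoid σ))] :
    ∑ q : _root_.Quotient (Equiv.Perm.SameCycle.setoid σ),
      ∑ j ∈ Finset.range (Function.minimalPeriod σ q.out), g (σ^[j] q.out) = ∑ d, g d := by
  classical
  rw [← Finset.sum_fiberwise (s := Finset.univ)
    (g := fun d => (_root_.Quotient.mk (Equiv.Perm.SameCycle.setoid σ) d)) (f := g)]
  refine Finset.sum_congr rfl fun q _ => ?_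
  refine Finset.sum_bij (fun j _ => σ^[j] q.out) ?_ ?_ ?_ (fun _ _ => rfl)
  · intro j _
    rw [Finset.mem_filter]
    refine ⟨Finset.mem_univ _, ?_⟩
    conv_rhs => rw [← _root_.Quotient.out_eq q]
    refine _root_.Quotient.sound ?_
    refine Equiv.Perm.SameCycle.symm ⟨j, ?_⟩
    rw [zpow_natCast, ← Equiv.Perm.iterate_eq_pow]
  · intro i hi j hj h
    exact Function.iterate_injOn_Iio_minimalPeriod (by simpa using hi) (by simpa using hj) h
  · intro d hd
    rw [Finset.mem_filter] at hd
    have h1 : σ.SameCycle q.out d := _root_.Quotient.exact ((_root_.Quotient.out_eq q).trans hd.2.symm)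
    obtain ⟨i, -, hi⟩ := h1.exists_pow_eq'
    rw [← Equiv.Perm.iterate_eq_pow] at hi
    have hpos : 0 < Function.minimalPeriod σ q.out :=
      Function.minimalPeriod_pos_of_mem_periodicPts
        (Function.Injective.mem_periodicPts σ.injective _)
    refine ⟨i % Function.minimalPeriod σ q.out, by simpa using Nat.mod_lt _ hpos, ?_⟩
    rw [Function.iterate_mod_minimalPeriod_eq, hi]

/-- The degree-two part of the real bar complex of a group: real combinations of the symbols `[a |
b]`. -/
abbrev BarChain₂ (G : Type) : Type := (G × G) →₀ ℝ

/-- The chain `∑ j < k, [g 0 ⋯ g (j-1) | g j]`, whose boundary is `(∑ j < k, [g j]) - [g 0 ⋯ g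
(k-1)]`. -/
noncomputable def barWord {G : Type} [Group G] (g : ℕ → G) (k : ℕ) : BarChain₂ G :=
  ∑ j ∈ Finset.range k, Finsupp.single (((List.range j).map g).prod, g j) 1

/-- Evaluation of a 2-cochain with real values on a chain. -/
noncomputable def evalChain {G : Type} (φ : G → G → ℝ) : BarChain₂ G →ₗ[ℝ] ℝ :=
  Finsupp.linearCombination ℝ fun x => φ x.1 x.2

theorem evalChain_single {G : Type} (φ : G → G → ℝ) (a b : G) :
    evalChain φ (Finsupp.single (a, b) 1) = φ a b := by
  simp [evalChain]

/-- The coboundary of a 1-cochain with (trivial) real coefficients; evaluating it on a chain is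
evaluating `w` on the boundary `∂[a | b] = [b] - [a b] + [a]`. -/
def coboundary₁₂ {G : Type} [Group G] (w : G → ℝ) (a b : G) : ℝ := w b - w (a * b) + w a

theorem evalChain_barWord {G : Type} [Group G] (w : G → ℝ) (hw : w 1 = 0) (g : ℕ → G) (k : ℕ) :
    evalChain (coboundary₁₂ w) (barWord g k) =
      (∑ j ∈ Finset.range k, w (g j)) - w ((List.range k).map g).prod := by
  induction k with
  | zero => simp [barWord, hw]
  | succ k ih =>
    have e : barWord g (k + 1) = barWord g k +
        Finsupp.single (((List.range k).map g).prod, g k) 1 := by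
      simp [barWord, Finset.sum_range_succ]
    rw [e, map_add, ih, evalChain_single, Finset.sum_range_succ, List.range_succ, List.map_append,
      List.prod_append]
    simp only [coboundary₁₂, List.map_cons, List.map_nil, List.prod_cons, List.prod_nil, mul_one]
    ring

/-- A compact oriented surface, possibly with boundary and possibly disconnected, presented as
finitely many disjoint oriented polygons some of whose sides are glued in pairs.

The elements of `Dart` are the sides of the polygons, each side being directed so that its polygon
lies on the left; `next d` is the side that follows `d` around the polygon, so that the polygons
are the cycles of `next`; the side `d` is glued to the side `glue d` with the opposite direction,
and `glue d = d` means that `d` is not glued to anything, that is, lies on the boundary. -/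
structure PolygonSurface where
  Dart : Type
  [fintypeDart : Fintype Dart]
  next : Equiv.Perm Dart
  glue : Equiv.Perm Dart
  glue_glue : ∀ d, glue (glue d) = d

attribute [instance] PolygonSurface.fintypeDart

namespace PolygonSurface

/-- If `d` is glued to `glue d`, then `next (glue d)` is the next side, clockwise, that starts at
the origin of `d`. If `d` lies on the boundary, then `rot d = next d`. So the cycles of `rot`
without sides on the boundary are the interior vertices of the surface, while a cycle that
contains sides on the boundary walks once along a boundary component, in the boundary orientation.
-/
def rot (S : PolygonSurface) : Equiv.Perm S.Dart := S.glue.trans S.next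

theorem rot_apply (S : PolygonSurface) (d : S.Dart) : S.rot d = S.next (S.glue d) := rfl

/-- The origin of the side `d` is an interior vertex of the surface. -/
def Interior (S : PolygonSurface) (d : S.Dart) : Prop :=
  ∀ e, S.rot.SameCycle d e → S.glue e ≠ e

/-- Elementary paths. A side `d` also stands for a base point in the interior of its polygon next
to `d`. There is a path `side d` inside the polygon to the base point of the next side and a path
`cross d` that crosses `d` to the base point of the side it is glued to. -/
inductive Step (S : PolygonSurface) : S.Dart → S.Dart → Type
  | side (d : S.Dart) : Step S d (S.next d)
  | cross (d : S.Dart) : Step S d (S.glue d)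

instance quiver (S : PolygonSurface) : Quiver S.Dart := ⟨S.Step⟩

/-- The free groupoid on the elementary paths. -/
abbrev FreeGpd (S : PolygonSurface) : Type := Quiver.FreeGroupoid S.Dart

namespace FreeGpd

variable (S : PolygonSurface)

/-- The base point next to the side `d`. -/
def pt (d : S.Dart) : S.FreeGpd := (Quiver.FreeGroupoid.of S.Dart).obj d

/-- The path inside a polygon from one side to the next. -/
def side (d : S.Dart) : pt S d ⟶ pt S (S.next d) :=
  (Quiver.FreeGroupoid.of S.Dart).map (Step.side d)

/-- The path across the side `d`. -/
def cross (d : S.Dart) : pt S d ⟶ pt S (S.glue d) :=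
  (Quiver.FreeGroupoid.of S.Dart).map (Step.cross d)

/-- The path past `k` consecutive sides of a polygon. -/
def sides : ∀ (k : ℕ) (d : S.Dart), pt S d ⟶ pt S (S.next^[k] d)
  | 0, d => 𝟙 (pt S d)
  | k + 1, d => side S d ≫ sides k (S.next d)

/-- The path past one side at the origin of `d`. -/
def turn (d : S.Dart) : pt S d ⟶ pt S (S.rot d) := cross S d ≫ side S (S.glue d)

/-- The path that takes `k` turns. -/
def turns : ∀ (k : ℕ) (d : S.Dart), pt S d ⟶ pt S (S.rot^[k] d)
  | 0, d => 𝟙 (pt S d)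
  | k + 1, d => turn S d ≫ turns k (S.rot d)

end FreeGpd

/-- The length of the cycle of `rot` through `d`. -/
noncomputable def valence (S : PolygonSurface) (d : S.Dart) : ℕ :=
  Function.minimalPeriod S.rot d

open FreeGpd in
/-- The relations of the orbifold fundamental groupoid: going around a polygon is trivial,
crossing a side back and forth is trivial, nothing is crossed at a boundary side, and at an
interior vertex with label `r` the loop around the vertex has trivial `r`-th power. So the label
`1` stands for a regular point, a label `r ≥ 2` for a cone point of order `r`, and the label `0`
for a point that is removed. Labels at boundary vertices have no meaning. -/
inductive Rel (S : PolygonSurface) (r : S.Dart → ℕ) : HomRel S.FreeGpd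
  | face (d : S.Dart) (k : ℕ) (h : d = S.next^[k] d) :
      Rel S r (sides S k d) (eqToHom (congrArg (pt S) h))
  | glue (d : S.Dart) (h : d = S.glue (S.glue d)) :
      Rel S r (cross S d ≫ cross S (S.glue d)) (eqToHom (congrArg (pt S) h))
  | free (d : S.Dart) (h : d = S.glue d) :
      Rel S r (cross S d) (eqToHom (congrArg (pt S) h))
  | vertex (d : S.Dart) (hd : S.Interior d) (h : d = S.rot^[S.valence d * r d] d) :
      Rel S r (turns S (S.valence d * r d) d) (eqToHom (congrArg (pt S) h))

/-- The fundamental groupoid of the orbifold with underlying surface `S` and labels `r`, based at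
the points next to the sides. -/
def Gpd (S : PolygonSurface) (r : S.Dart → ℕ) : Type := Quotient (S.Rel r)

/-- The groupoid structure of the fundamental groupoid. -/
instance gpdGroupoid (S : PolygonSurface) (r : S.Dart → ℕ) : Groupoid (S.Gpd r) :=
  inferInstanceAs (Groupoid (Quotient (S.Rel r)))

/-- The projection from the free groupoid. -/
def proj (S : PolygonSurface) (r : S.Dart → ℕ) : S.FreeGpd ⥤ S.Gpd r := Quotient.functor (S.Rel r)

variable (S : PolygonSurface) (r : S.Dart → ℕ)

/-- The base point next to the side `d`, as an object of the fundamental groupoid. -/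
def pt (d : S.Dart) : S.Gpd r := (S.proj r).obj (FreeGpd.pt S d)

/-- The class of the path from one side of a polygon to the next. -/
def side (d : S.Dart) : S.pt r d ⟶ S.pt r (S.next d) := (S.proj r).map (FreeGpd.side S d)

/-- The class of the path across the side `d`. -/
def cross (d : S.Dart) : S.pt r d ⟶ S.pt r (S.glue d) := (S.proj r).map (FreeGpd.cross S d)

/-- The class of the path past one side at the origin of `d`. -/
def turn (d : S.Dart) : S.pt r d ⟶ S.pt r (S.rot d) := S.cross r d ≫ S.side r (S.glue d)

theorem iterate_valence (d : S.Dart) : S.rot^[S.valence d] d = d :=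
  Function.iterate_minimalPeriod

/-- The loop that follows the whole cycle of `rot` through `d`: the clockwise loop around an
interior vertex, or the loop along a boundary component in the boundary orientation. -/
noncomputable def link (d : S.Dart) : S.pt r d ⟶ S.pt r d :=
  (S.proj r).map (FreeGpd.turns S (S.valence d) d) ≫
    eqToHom (congrArg (S.pt r) (S.iterate_valence d))

/-- The base points `p` and `d` lie in the same connected component. -/
def Conn (p d : S.Dart) : Prop := Nonempty (S.pt r p ⟶ S.pt r d)

/-- The orbifold fundamental group at the base point `p`; the product is the concatenation of
paths. -/
abbrev Pi1 (p : S.Dart) : Type := S.pt r p ⟶ S.pt r p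

open Classical in
/-- The loop at `p` that is obtained from a path by joining its end points to `p` along paths that
are chosen once for every base point in the component of `p`. Outside this component the value is
irrelevant. -/
noncomputable def toLoop (p : S.Dart) {a b : S.Dart} (f : S.pt r a ⟶ S.pt r b) : S.Pi1 r p :=
  if h : S.Conn r p a then
    h.some ≫ f ≫ inv (Nonempty.map (fun g => g ≫ f) h : S.Conn r p b).some
  else 𝟙 _

open Classical in
/-- The gluing that is left when the sides in `C`, and those glued to them, are no longer glued.
-/
noncomputable def cutGlue (C : Set S.Dart) (d : S.Dart) : S.Dart :=
  if d ∈ C ∨ S.glue d ∈ C then d else S.glue d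

theorem cutGlue_invol (C : Set S.Dart) : Function.Involutive (S.cutGlue C) := by
  intro d
  by_cases h : d ∈ C ∨ S.glue d ∈ C
  · have e : S.cutGlue C d = d := by simp only [cutGlue, h, if_true]
    rw [e, e]
  · have e : S.cutGlue C d = S.glue d := by simp only [cutGlue, h, if_false]
    have h' : ¬ (S.glue d ∈ C ∨ S.glue (S.glue d) ∈ C) := by
      rw [S.glue_glue]; tauto
    rw [e, cutGlue, if_neg h', S.glue_glue]

/-- The surface cut open along the sides in `C`: the completion of the complement of these sides.
-/
noncomputable abbrev cut (C : Set S.Dart) : PolygonSurface where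
  Dart := S.Dart
  next := S.next
  glue := (S.cutGlue_invol C).toPerm
  glue_glue := S.cutGlue_invol C

theorem cut_glue_of_mem {C : Set S.Dart} {d : S.Dart} (h : d ∈ C ∨ S.glue d ∈ C) :
    (S.cut C).glue d = d := by
  change S.cutGlue C d = d
  simp [cutGlue, h]

theorem cut_glue_of_not_mem {C : Set S.Dart} {d : S.Dart} (h : ¬ (d ∈ C ∨ S.glue d ∈ C)) :
    (S.cut C).glue d = S.glue d := by
  change S.cutGlue C d = _
  simp only [cutGlue, h, if_false]

open Classical in
/-- An elementary path of the surface that is cut open along `C`, as a path of the original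
surface. -/
noncomputable def reglueStep (C : Set S.Dart) :
    ∀ {a b : S.Dart}, (S.cut C).Step a b → (S.pt r a ⟶ S.pt r b)
  | _, _, .side d => S.side r d
  | _, _, .cross d =>
    if h : d ∈ C ∨ S.glue d ∈ C then
      eqToHom (congrArg (S.pt r) (S.cut_glue_of_mem h).symm)
    else
      S.cross r d ≫ eqToHom (congrArg (S.pt r) (S.cut_glue_of_not_mem h).symm)

/-- The same for all words in the elementary paths. -/
noncomputable def reglueFree (C : Set S.Dart) : (S.cut C).FreeGpd ⥤ S.Gpd r :=
  Quiver.FreeGroupoid.lift (V := (S.cut C).Dart)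
    { obj := fun d => S.pt r d
      map := fun f => S.reglueStep r C f }

theorem reglueFree_obj (C : Set S.Dart) (d : S.Dart) :
    (S.reglueFree r C).obj (FreeGpd.pt (S.cut C) d) = S.pt r d := rfl

theorem reglueFree_map (C : Set S.Dart) {a b : S.Dart} (f : (S.cut C).Step a b) :
    (S.reglueFree r C).map
      ((Quiver.FreeGroupoid.of (S.cut C).Dart).map (X := a) (Y := b) f) = S.reglueStep r C f := by
  have := Quiver.FreeGroupoid.lift_spec (V := (S.cut C).Dart) (V' := S.Gpd r)
    { obj := fun d => S.pt r d
      map := fun f => S.reglueStep r C f }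
  have h2 := Prefunctor.congr_hom this f
  exact h2

theorem reglueFree_side (C : Set S.Dart) (d : S.Dart) :
    (S.reglueFree r C).map (FreeGpd.side (S.cut C) d) = S.side r d :=
  S.reglueFree_map r C (Step.side (S := S.cut C) d)

theorem reglueFree_cross_of_mem (C : Set S.Dart) {d : S.Dart} (h : d ∈ C ∨ S.glue d ∈ C) :
    (S.reglueFree r C).map (FreeGpd.cross (S.cut C) d) =
      eqToHom (congrArg (S.pt r) (S.cut_glue_of_mem h).symm) := by
  refine (S.reglueFree_map r C (Step.cross (S := S.cut C) d)).trans ?_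
  exact dif_pos h

theorem reglueFree_cross_of_not_mem (C : Set S.Dart) {d : S.Dart}
    (h : ¬ (d ∈ C ∨ S.glue d ∈ C)) :
    (S.reglueFree r C).map (FreeGpd.cross (S.cut C) d) =
      S.cross r d ≫ eqToHom (congrArg (S.pt r) (S.cut_glue_of_not_mem h).symm) := by
  refine (S.reglueFree_map r C (Step.cross (S := S.cut C) d)).trans ?_
  exact dif_neg h

theorem eqToHom_side {a b : S.Dart} (h : a = b) :
    eqToHom (congrArg (S.pt r) h) ≫ S.side r b =
      S.side r a ≫ eqToHom (congrArg (S.pt r) (congrArg S.next h)) := by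
  subst h; simp

theorem eqToHom_turns {a b : S.Dart} (h : a = b) (k : ℕ) :
    eqToHom (congrArg (S.pt r) h) ≫ (S.proj r).map (FreeGpd.turns S k b) =
      (S.proj r).map (FreeGpd.turns S k a) ≫
        eqToHom (congrArg (S.pt r) (congrArg (S.rot^[k]) h)) := by
  subst h
  simp only [eqToHom_refl]
  exact (Category.id_comp _).trans (Category.comp_id _).symm

theorem reglueFree_sides (C : Set S.Dart) (k : ℕ) (d : S.Dart) :
    (S.reglueFree r C).map (FreeGpd.sides (S.cut C) k d) =
      (S.proj r).map (FreeGpd.sides S k d) := by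
  induction k generalizing d with
  | zero => exact ((S.reglueFree r C).map_id _).trans ((S.proj r).map_id _).symm
  | succ k ih =>
    refine ((S.reglueFree r C).map_comp _ _).trans ?_
    refine Eq.trans ?_ ((S.proj r).map_comp _ _).symm
    exact congr (congrArg _ (S.reglueFree_side r C d)) (ih (S.next d))

theorem reglueFree_turns (C : Set S.Dart) (k : ℕ) (d : S.Dart)
    (H : ∀ j < k, (S.cut C).glue ((S.cut C).rot^[j] d) ≠ (S.cut C).rot^[j] d) :
    ∃ h : S.rot^[k] d = (S.cut C).rot^[k] d,
      (S.reglueFree r C).map (FreeGpd.turns (S.cut C) k d) =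
        (S.proj r).map (FreeGpd.turns S k d) ≫ eqToHom (congrArg (S.pt r) h) := by
  induction k generalizing d with
  | zero =>
    refine ⟨rfl, ?_⟩
    refine ((S.reglueFree r C).map_id _).trans ?_
    refine Eq.trans ?_ (Category.comp_id _).symm
    exact ((S.proj r).map_id _).symm
  | succ k ih =>
    have hd : ¬ (d ∈ C ∨ S.glue d ∈ C) := fun h => H 0 (Nat.succ_pos k) (S.cut_glue_of_mem h)
    have hg : S.glue d = (S.cut C).glue d := (S.cut_glue_of_not_mem hd).symm
    have hr : S.rot d = (S.cut C).rot d := congrArg S.next hg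
    obtain ⟨h, e⟩ := ih ((S.cut C).rot d) (fun j hj => H (j + 1) (Nat.succ_lt_succ hj))
    refine ⟨(congrArg (S.rot^[k]) hr).trans h, ?_⟩
    have e1 : (S.reglueFree r C).map (FreeGpd.turn (S.cut C) d) =
        S.turn r d ≫ eqToHom (congrArg (S.pt r) hr) := by
      refine ((S.reglueFree r C).map_comp _ _).trans ?_
      refine (congr (congrArg _ (S.reglueFree_cross_of_not_mem r C hd))
        (S.reglueFree_side r C _)).trans ?_
      refine (Category.assoc _ _ _).trans ?_
      refine (congrArg _ (S.eqToHom_side r hg)).trans ?_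
      exact (Category.assoc _ _ _).symm
    refine ((S.reglueFree r C).map_comp _ _).trans ?_
    refine (congr (congrArg _ e1) e).trans ?_
    have e2 := S.eqToHom_turns r hr k
    have e3 : (S.proj r).map (FreeGpd.turns S (k + 1) d) =
        S.turn r d ≫ (S.proj r).map (FreeGpd.turns S k (S.rot d)) :=
      (S.proj r).map_comp _ _
    refine Eq.trans ?_ (congrArg (· ≫ eqToHom _) e3).symm
    refine (Category.assoc _ _ _).trans ?_
    refine (congrArg (S.turn r d ≫ ·) (Category.assoc _ _ _).symm).trans ?_
    refine (congrArg (fun z => S.turn r d ≫ z ≫ eqToHom (congrArg (S.pt r) h)) e2).trans ?_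
    refine (congrArg (S.turn r d ≫ ·) (Category.assoc _ _ _)).trans ?_
    refine (Category.assoc _ _ _).symm.trans ?_
    refine (congrArg _ (eqToHom_trans _ _)).trans ?_
    rfl

theorem cut_interior (C : Set S.Dart) {d : S.Dart} (hd : (S.cut C).Interior d) (j : ℕ) :
    (S.cut C).rot^[j] d = S.rot^[j] d := by
  have H : ∀ j, (S.cut C).glue ((S.cut C).rot^[j] d) ≠ (S.cut C).rot^[j] d := fun j =>
    hd _ ⟨j, by rw [zpow_natCast, ← Equiv.Perm.iterate_eq_pow]⟩
  obtain ⟨h, -⟩ := S.reglueFree_turns (fun _ => 0) C j d (fun i _ => H i)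
  exact h.symm

theorem interior_of_cut (C : Set S.Dart) {d : S.Dart} (hd : (S.cut C).Interior d) :
    S.Interior d := by
  intro e he hge
  obtain ⟨j, -, hj⟩ := he.exists_pow_eq' 
  rw [← Equiv.Perm.iterate_eq_pow] at hj
  have h1 := S.cut_interior C hd j
  refine hd e ⟨j, by rw [zpow_natCast, ← Equiv.Perm.iterate_eq_pow, h1, hj]⟩ ?_
  by_cases h : e ∈ C ∨ S.glue e ∈ C
  · exact S.cut_glue_of_mem h
  · rw [S.cut_glue_of_not_mem h, hge]

theorem cut_valence (C : Set S.Dart) {d : S.Dart} (hd : (S.cut C).Interior d) :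
    (S.cut C).valence d = S.valence d := by
  apply Nat.dvd_antisymm
  · apply Function.IsPeriodicPt.minimalPeriod_dvd
    change (S.cut C).rot^[_] d = d
    rw [S.cut_interior C hd]
    exact S.iterate_valence d
  · apply Function.IsPeriodicPt.minimalPeriod_dvd
    change S.rot^[_] d = d
    rw [← S.cut_interior C hd]
    exact (S.cut C).iterate_valence d

theorem gpd_face (d : S.Dart) (k : ℕ) (h : d = S.next^[k] d) :
    (S.proj r).map (FreeGpd.sides S k d) = eqToHom (congrArg (S.pt r) h) := by
  refine (CategoryTheory.Quotient.sound (S.Rel r) (Rel.face d k h)).trans ?_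
  exact eqToHom_map (S.proj r) _

theorem gpd_glue (d : S.Dart) (h : d = S.glue (S.glue d)) :
    S.cross r d ≫ S.cross r (S.glue d) = eqToHom (congrArg (S.pt r) h) := by
  refine ((S.proj r).map_comp _ _).symm.trans ?_
  refine (CategoryTheory.Quotient.sound (S.Rel r) (Rel.glue d h)).trans ?_
  exact eqToHom_map (S.proj r) _

theorem gpd_free (d : S.Dart) (h : d = S.glue d) :
    S.cross r d = eqToHom (congrArg (S.pt r) h) := by
  refine (CategoryTheory.Quotient.sound (S.Rel r) (Rel.free d h)).trans ?_
  exact eqToHom_map (S.proj r) _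

theorem gpd_vertex (d : S.Dart) (hd : S.Interior d) (h : d = S.rot^[S.valence d * r d] d) :
    (S.proj r).map (FreeGpd.turns S (S.valence d * r d) d) = eqToHom (congrArg (S.pt r) h) := by
  refine (CategoryTheory.Quotient.sound (S.Rel r) (Rel.vertex d hd h)).trans ?_
  exact eqToHom_map (S.proj r) _

theorem reglue_rel (C : Set S.Dart) (x y : (S.cut C).FreeGpd) (f g : x ⟶ y)
    (h : (S.cut C).Rel r f g) : (S.reglueFree r C).map f = (S.reglueFree r C).map g := by
  cases h with
  | face d k h =>
    rw [eqToHom_map, reglueFree_sides]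
    exact S.gpd_face r d k h
  | glue d h =>
    rw [eqToHom_map]
    refine ((S.reglueFree r C).map_comp _ _).trans ?_
    by_cases hd : d ∈ C ∨ S.glue d ∈ C
    · have hd' : (S.cut C).glue d ∈ C ∨ S.glue ((S.cut C).glue d) ∈ C := by
        rw [S.cut_glue_of_mem hd]; exact hd
      refine (congr (congrArg _ (S.reglueFree_cross_of_mem r C hd))
        (S.reglueFree_cross_of_mem r C hd')).trans ?_
      exact eqToHom_trans _ _
    · have hd' : ¬ ((S.cut C).glue d ∈ C ∨ S.glue ((S.cut C).glue d) ∈ C) := by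
        rw [S.cut_glue_of_not_mem hd, S.glue_glue]; tauto
      refine (congr (congrArg _ (S.reglueFree_cross_of_not_mem r C hd))
        (S.reglueFree_cross_of_not_mem r C hd')).trans ?_
      have key : ∀ (b : S.Dart) (hb : S.glue d = b) (z : S.Gpd r)
          (h1 : S.pt r (S.glue b) = z) (h2 : S.pt r d = z),
          (S.cross r d ≫ eqToHom (congrArg (S.pt r) hb)) ≫ S.cross r b ≫ eqToHom h1
            = eqToHom h2 := by
        rintro b rfl z h1 h2
        rw [eqToHom_refl, Category.comp_id, ← Category.assoc,
          S.gpd_glue r d (S.glue_glue d).symm, eqToHom_trans]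
      exact key _ (S.cut_glue_of_not_mem hd).symm _ _ _
  | free d h =>
    rw [eqToHom_map]
    by_cases hd : d ∈ C ∨ S.glue d ∈ C
    · exact S.reglueFree_cross_of_mem r C hd
    · refine (S.reglueFree_cross_of_not_mem r C hd).trans ?_
      have h' : d = S.glue d := h.trans (S.cut_glue_of_not_mem hd)
      rw [S.gpd_free r d h', eqToHom_trans]
      rfl
  | vertex d hd h =>
    rw [eqToHom_map]
    have H : ∀ j, (S.cut C).glue ((S.cut C).rot^[j] d) ≠ (S.cut C).rot^[j] d := fun j =>
      hd _ ⟨j, by rw [zpow_natCast, ← Equiv.Perm.iterate_eq_pow]⟩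
    obtain ⟨h1, e⟩ := S.reglueFree_turns r C ((S.cut C).valence d * r d) d (fun j _ => H j)
    refine e.trans ?_
    have key : ∀ (k : ℕ) (hk : k = S.valence d * r d) (z : S.Gpd r)
        (h1 : S.pt r (S.rot^[k] d) = z) (h2 : S.pt r d = z),
        (S.proj r).map (FreeGpd.turns S k d) ≫ eqToHom h1 = eqToHom h2 := by
      rintro k rfl z h1 h2
      have hp : d = S.rot^[S.valence d * r d] d := by
        have : Function.IsPeriodicPt S.rot (S.valence d * r d) d :=
          Function.IsPeriodicPt.mul_const (S.iterate_valence d) _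
        exact this.symm
      rw [S.gpd_vertex r d (S.interior_of_cut C hd) hp]
      exact eqToHom_trans _ _
    exact key _ (by rw [S.cut_valence C hd]) _ _ _

/-- The functor of fundamental groupoids that is induced by the map from the surface cut open
along `C` to the original surface. Labels of vertices that are not cut are the same on both sides.
-/
noncomputable def reglue (C : Set S.Dart) : (S.cut C).Gpd r ⥤ S.Gpd r :=
  CategoryTheory.Quotient.lift ((S.cut C).Rel r) (S.reglueFree r C) (S.reglue_rel r C)

/-- The change of base point along the path `h`. -/
noncomputable def changeBase {p q : S.Dart} (h : S.pt r p ⟶ S.pt r q) :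
    S.Pi1 r q →* S.Pi1 r p where
  toFun g := h ≫ g ≫ inv h
  map_one' := by
    change h ≫ 𝟙 _ ≫ inv h = 𝟙 _
    rw [Category.id_comp, IsIso.hom_inv_id]
  map_mul' f g := by
    change h ≫ (f ≫ g) ≫ inv h = (h ≫ f ≫ inv h) ≫ (h ≫ g ≫ inv h)
    simp

/-- The homomorphism of fundamental groups that is induced by the map from the surface cut open
along `C` to the original surface. -/
noncomputable def reglueHom (C : Set S.Dart) (q : S.Dart) : (S.cut C).Pi1 r q →* S.Pi1 r q where
  toFun g := (S.reglue r C).map g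
  map_one' := (S.reglue r C).map_id _
  map_mul' f g := (S.reglue r C).map_comp f g

/-- The homomorphism from the fundamental group of a piece of the surface cut open along `C` to
the fundamental group of the original surface; the base points are joined by the path `h`. -/
noncomputable def inclusion (C : Set S.Dart) {p q : S.Dart} (h : S.pt r p ⟶ S.pt r q) :
    (S.cut C).Pi1 r q →* S.Pi1 r p :=
  (S.changeBase r h).comp (S.reglueHom r C q)

theorem toLoop_comp (p : S.Dart) {a b c : S.Dart} (f : S.pt r a ⟶ S.pt r b)
    (g : S.pt r b ⟶ S.pt r c) :
    S.toLoop r p (f ≫ g) = S.toLoop r p f * S.toLoop r p g := by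
  by_cases ha : S.Conn r p a
  · have hb : S.Conn r p b := Nonempty.map (fun g => g ≫ f) ha
    simp [toLoop, ha, hb]
  · have hb : ¬ S.Conn r p b := fun h => ha (Nonempty.map (fun g => g ≫ inv f) h)
    simp only [toLoop, ha, hb, dif_neg, not_false_iff]
    exact (Category.comp_id _).symm

theorem toLoop_eqToHom (p : S.Dart) {a b : S.Dart} (h : a = b) :
    S.toLoop r p (eqToHom (congrArg (S.pt r) h)) = 1 := by
  subst h
  by_cases ha : S.Conn r p a
  · simp [toLoop, ha]
  · simp only [toLoop, ha, dif_neg, not_false_iff]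
    rfl

/-- The polygons. -/
def Face : Type := _root_.Quotient (Equiv.Perm.SameCycle.setoid S.next)

/-- The cycles of `rot`: interior vertices and boundary components. -/
def Vertex : Type := _root_.Quotient (Equiv.Perm.SameCycle.setoid S.rot)

noncomputable instance : Fintype S.Face :=
  @Fintype.ofFinite _ (inferInstanceAs
    (Finite (_root_.Quotient (Equiv.Perm.SameCycle.setoid S.next))))

noncomputable instance : Fintype S.Vertex :=
  @Fintype.ofFinite _ (inferInstanceAs
    (Finite (_root_.Quotient (Equiv.Perm.SameCycle.setoid S.rot))))

/-- A side of the polygon. -/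
noncomputable def Face.dart {S : PolygonSurface} (f : S.Face) : S.Dart := _root_.Quotient.out f

/-- A side in the cycle. -/
noncomputable def Vertex.dart {S : PolygonSurface} (v : S.Vertex) : S.Dart := _root_.Quotient.out v

/-- The successive turns along the cycle of `rot` through `d`, as elements of the fundamental
group. -/
noncomputable def vertexLetters (p d : S.Dart) (j : ℕ) : S.Pi1 r p :=
  S.toLoop r p (S.turn r (S.rot^[j] d))

/-- The successive steps around the polygon of `d`, as elements of the fundamental group. -/
noncomputable def faceLetters (p d : S.Dart) (j : ℕ) : S.Pi1 r p :=
  S.toLoop r p (S.side r (S.next^[j] d))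

/-- The number of sides of a polygon. -/
noncomputable def faceSize (f : S.Face) : ℕ := Function.minimalPeriod S.next f.dart

theorem toLoop_turns (p d : S.Dart) (k : ℕ) :
    S.toLoop r p ((S.proj r).map (FreeGpd.turns S k d)) =
      ((List.range k).map (S.vertexLetters r p d)).prod := by
  induction k generalizing d with
  | zero => exact S.toLoop_eqToHom r p rfl
  | succ k ih =>
    have e3 : (S.proj r).map (FreeGpd.turns S (k + 1) d) =
        S.turn r d ≫ (S.proj r).map (FreeGpd.turns S k (S.rot d)) :=
      (S.proj r).map_comp _ _
    refine (congrArg (S.toLoop r p) e3).trans ?_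
    refine (S.toLoop_comp r p _ _).trans ?_
    rw [List.range_succ_eq_map, List.map_cons, List.prod_cons, List.map_map]
    exact congrArg _ (ih _)

theorem toLoop_sides (p d : S.Dart) (k : ℕ) :
    S.toLoop r p ((S.proj r).map (FreeGpd.sides S k d)) =
      ((List.range k).map (S.faceLetters r p d)).prod := by
  induction k generalizing d with
  | zero => exact S.toLoop_eqToHom r p rfl
  | succ k ih =>
    have e3 : (S.proj r).map (FreeGpd.sides S (k + 1) d) =
        S.side r d ≫ (S.proj r).map (FreeGpd.sides S k (S.next d)) :=
      (S.proj r).map_comp _ _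
    refine (congrArg (S.toLoop r p) e3).trans ?_
    refine (S.toLoop_comp r p _ _).trans ?_
    rw [List.range_succ_eq_map, List.map_cons, List.prod_cons, List.map_map]
    exact congrArg _ (ih _)

theorem toLoop_link (p d : S.Dart) :
    S.toLoop r p (S.link r d) =
      ((List.range (S.valence d)).map (S.vertexLetters r p d)).prod := by
  refine (S.toLoop_comp r p _ _).trans ?_
  refine (congr (congrArg _ (S.toLoop_turns r p d _))
    (S.toLoop_eqToHom r p (S.iterate_valence d))).trans ?_
  exact mul_one _

theorem prod_faceLetters (p : S.Dart) (f : S.Face) :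
    ((List.range (S.faceSize f)).map (S.faceLetters r p f.dart)).prod = 1 := by
  have h : f.dart = S.next^[S.faceSize f] f.dart := Function.iterate_minimalPeriod.symm
  rw [← S.toLoop_sides, S.gpd_face r _ _ h]
  exact S.toLoop_eqToHom r p h

theorem prod_vertexLetters (p d : S.Dart) (hd : S.Interior d) :
    ((List.range (S.valence d * r d)).map (S.vertexLetters r p d)).prod = 1 := by
  have h : d = S.rot^[S.valence d * r d] d :=
    (Function.IsPeriodicPt.mul_const (S.iterate_valence d) _ :
      Function.IsPeriodicPt S.rot _ _).symm
  rw [← S.toLoop_turns, S.gpd_vertex r d hd h]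
  exact S.toLoop_eqToHom r p h

open Classical in
/-- The fundamental chain of the component of `p`, in the real bar complex of its orbifold
fundamental group. The surface is cut into polygons (first sum), two-gons across the glued sides
(second sum, where each two-gon occurs for both of its sides), triangles that write a turn as a
crossing followed by a side (third sum), and regions around the interior vertices and along the
boundary components that are bounded by turns (fourth and fifth sum); the signs are those of the
orientation. The region around a cone point of order `r` is filled by the relation that the `r`-th
power of its boundary is trivial, with weight `1 / r`. Together with the boundary loops the chain
represents the relative fundamental class: its boundary is the sum of the boundary loops, see
`evalChain_fundamentalChain`. -/
noncomputable def fundamentalChain (p : S.Dart) : BarChain₂ (S.Pi1 r p) :=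
  (∑ f : S.Face with S.Conn r p f.dart, barWord (S.faceLetters r p f.dart) (S.faceSize f))
  + (1 / 2 : ℝ) • (∑ d : S.Dart with S.Conn r p d,
      Finsupp.single (S.toLoop r p (S.cross r d), S.toLoop r p (S.cross r (S.glue d))) 1)
  - (∑ d : S.Dart with S.Conn r p d,
      Finsupp.single (S.toLoop r p (S.cross r d), S.toLoop r p (S.side r (S.glue d))) 1)
  - (∑ v : S.Vertex with S.Conn r p v.dart ∧ S.Interior v.dart,
      (1 / r v.dart : ℝ) •
        barWord (S.vertexLetters r p v.dart) (S.valence v.dart * r v.dart))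
  - (∑ v : S.Vertex with S.Conn r p v.dart ∧ ¬ S.Interior v.dart,
      barWord (S.vertexLetters r p v.dart) (S.valence v.dart))

theorem toLoop_of_not_conn (p : S.Dart) {a b : S.Dart} (h : ¬ S.Conn r p a)
    (f : S.pt r a ⟶ S.pt r b) : S.toLoop r p f = 1 := by
  simp only [toLoop, h, dif_neg, not_false_iff]
  rfl

theorem conn_next (p d : S.Dart) : S.Conn r p d ↔ S.Conn r p (S.next d) :=
  ⟨Nonempty.map (fun g => g ≫ S.side r d), Nonempty.map (fun g => g ≫ inv (S.side r d))⟩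

theorem conn_glue (p d : S.Dart) : S.Conn r p d ↔ S.Conn r p (S.glue d) :=
  ⟨Nonempty.map (fun g => g ≫ S.cross r d), Nonempty.map (fun g => g ≫ inv (S.cross r d))⟩

theorem conn_rot (p d : S.Dart) : S.Conn r p d ↔ S.Conn r p (S.rot d) :=
  (S.conn_glue r p d).trans (S.conn_next r p _)

/-- The boundary of the fundamental chain is the sum of the boundary loops. -/
theorem evalChain_fundamentalChain (p : S.Dart) (hr : ∀ d, 0 < r d)
    (w : S.Pi1 r p → ℝ) (hw : w 1 = 0) :
    evalChain (coboundary₁₂ w) (S.fundamentalChain r p) =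
      open Classical in
      ∑ v : S.Vertex with S.Conn r p v.dart ∧ ¬ S.Interior v.dart,
        w (S.toLoop r p (S.link r v.dart)) := by
  classical
  have hF : ∀ f : S.Face, evalChain (coboundary₁₂ w)
      (barWord (S.faceLetters r p f.dart) (S.faceSize f)) =
      ∑ j ∈ Finset.range (S.faceSize f), w (S.toLoop r p (S.side r (S.next^[j] f.dart))) := by
    intro f
    rw [evalChain_barWord w hw, S.prod_faceLetters, hw, sub_zero]
    rfl
  have hF' : ∑ f : S.Face with S.Conn r p f.dart, evalChain (coboundary₁₂ w)
      (barWord (S.faceLetters r p f.dart) (S.faceSize f)) =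
      ∑ d, w (S.toLoop r p (S.side r d)) := by
    rw [Finset.sum_filter_of_ne]
    · rw [Finset.sum_congr rfl fun f _ => hF f]
      exact @sum_orbits S.Dart ℝ _ _ S.next (fun d => w (S.toLoop r p (S.side r d)))
        (inferInstance : Fintype S.Face)
    · intro f _ hne
      by_contra hc
      refine hne ?_
      rw [hF f]
      refine Finset.sum_eq_zero fun j _ => ?_
      rw [S.toLoop_of_not_conn, hw]
      have : ∀ (j : ℕ) (d : S.Dart), S.Conn r p (S.next^[j] d) → S.Conn r p d := by
        intro j
        induction j with
        | zero => exact fun d h => h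
        | succ j ih => exact fun d h => (S.conn_next r p d).2 (ih _ h)
      exact fun h => hc (this _ _ h)
  have hit : ∀ (j : ℕ) (d : S.Dart), S.Conn r p (S.rot^[j] d) → S.Conn r p d := by
    intro j
    induction j with
    | zero => exact fun d h => h
    | succ j ih => exact fun d h => (S.conn_rot r p d).2 (ih _ h)
  have hVb : ∀ v : S.Vertex, evalChain (coboundary₁₂ w)
      (barWord (S.vertexLetters r p v.dart) (S.valence v.dart)) =
      (∑ j ∈ Finset.range (S.valence v.dart), w (S.toLoop r p (S.turn r (S.rot^[j] v.dart))))
        - w (S.toLoop r p (S.link r v.dart)) := by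
    intro v
    rw [evalChain_barWord w hw, S.toLoop_link]
    rfl
  have hmul : ∀ (g : ℕ → ℝ) (k m : ℕ), (∀ j, g (j + k) = g j) →
      ∑ j ∈ Finset.range (k * m), g j = m * ∑ j ∈ Finset.range k, g j := by
    intro g k m hg
    induction m with
    | zero => simp
    | succ m ih =>
      have hg' : ∀ j, g (k * m + j) = g j := by
        intro j
        clear ih
        induction m with
        | zero => simp
        | succ m ih => rw [show k * (m + 1) + j = (k * m + j) + k by ring, hg, ih]
      rw [Nat.mul_succ, Finset.sum_range_add, ih, Finset.sum_congr rfl fun j _ => hg' j]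
      push_cast
      ring
  have hVi : ∀ v : S.Vertex, S.Interior v.dart → (1 / r v.dart : ℝ) * evalChain (coboundary₁₂ w)
      (barWord (S.vertexLetters r p v.dart) (S.valence v.dart * r v.dart)) =
      ∑ j ∈ Finset.range (S.valence v.dart), w (S.toLoop r p (S.turn r (S.rot^[j] v.dart))) := by
    intro v hv
    rw [evalChain_barWord w hw, S.prod_vertexLetters r p _ hv, hw, sub_zero, hmul]
    · have : (r v.dart : ℝ) ≠ 0 := by exact_mod_cast (hr v.dart).ne'
      field_simp
      rfl
    · intro j
      simp only [vertexLetters]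
      rw [Function.iterate_add_apply, S.iterate_valence]
  have hV : (∑ v : S.Vertex with S.Conn r p v.dart ∧ S.Interior v.dart,
        ∑ j ∈ Finset.range (S.valence v.dart), w (S.toLoop r p (S.turn r (S.rot^[j] v.dart))))
      + (∑ v : S.Vertex with S.Conn r p v.dart ∧ ¬ S.Interior v.dart,
        ∑ j ∈ Finset.range (S.valence v.dart), w (S.toLoop r p (S.turn r (S.rot^[j] v.dart))))
      = ∑ d, w (S.toLoop r p (S.turn r d)) := by
    rw [← Finset.filter_filter, ← Finset.filter_filter,
      Finset.sum_filter_add_sum_filter_not, Finset.sum_filter_of_ne]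
    · exact @sum_orbits S.Dart ℝ _ _ S.rot (fun d => w (S.toLoop r p (S.turn r d)))
        (inferInstance : Fintype S.Vertex)
    · intro v _ hne
      by_contra hc
      refine hne (Finset.sum_eq_zero fun j _ => ?_)
      rw [S.toLoop_of_not_conn, hw]
      exact fun h => hc (hit _ _ h)
  have hE : ∑ d : S.Dart with S.Conn r p d, evalChain (coboundary₁₂ w)
      (Finsupp.single (S.toLoop r p (S.cross r d), S.toLoop r p (S.cross r (S.glue d))) 1) =
      2 * ∑ d, w (S.toLoop r p (S.cross r d)) := by
    have h1 : ∀ d, evalChain (coboundary₁₂ w)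
        (Finsupp.single (S.toLoop r p (S.cross r d), S.toLoop r p (S.cross r (S.glue d))) 1) =
        w (S.toLoop r p (S.cross r (S.glue d))) + w (S.toLoop r p (S.cross r d)) := by
      intro d
      rw [evalChain_single, coboundary₁₂, ← S.toLoop_comp, S.gpd_glue r d (S.glue_glue d).symm,
        S.toLoop_eqToHom r p (S.glue_glue d).symm, hw, sub_zero]
    rw [Finset.sum_congr rfl fun d _ => h1 d, Finset.sum_filter_of_ne]
    · rw [Finset.sum_add_distrib, Equiv.sum_comp S.glue fun d => w (S.toLoop r p (S.cross r d))]
      ring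
    · intro d _ hne
      by_contra hc
      refine hne ?_
      rw [S.toLoop_of_not_conn r p hc,
        S.toLoop_of_not_conn r p (fun h => hc ((S.conn_glue r p d).2 h)), hw, add_zero]
  have hT : ∑ d : S.Dart with S.Conn r p d, evalChain (coboundary₁₂ w)
      (Finsupp.single (S.toLoop r p (S.cross r d), S.toLoop r p (S.side r (S.glue d))) 1) =
      (∑ d, w (S.toLoop r p (S.side r d))) + (∑ d, w (S.toLoop r p (S.cross r d)))
        - ∑ d, w (S.toLoop r p (S.turn r d)) := by
    have h1 : ∀ d, evalChain (coboundary₁₂ w)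
        (Finsupp.single (S.toLoop r p (S.cross r d), S.toLoop r p (S.side r (S.glue d))) 1) =
        w (S.toLoop r p (S.side r (S.glue d))) - w (S.toLoop r p (S.turn r d))
          + w (S.toLoop r p (S.cross r d)) := by
      intro d
      rw [evalChain_single, coboundary₁₂, ← S.toLoop_comp]
      rfl
    rw [Finset.sum_congr rfl fun d _ => h1 d, Finset.sum_filter_of_ne]
    · rw [Finset.sum_add_distrib, Finset.sum_sub_distrib,
        Equiv.sum_comp S.glue fun d => w (S.toLoop r p (S.side r d))]
      ring
    · intro d _ hne
      by_contra hc
      refine hne ?_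
      rw [S.toLoop_of_not_conn r p hc, S.toLoop_of_not_conn r p hc,
        S.toLoop_of_not_conn r p (fun h => hc ((S.conn_glue r p d).2 h)), hw]
      ring
  simp only [fundamentalChain, map_sub, map_add, map_smul, map_sum, smul_eq_mul]
  rw [hF', hE, hT]
  have hI : ∑ v : S.Vertex with S.Conn r p v.dart ∧ S.Interior v.dart,
      (1 / r v.dart : ℝ) * evalChain (coboundary₁₂ w)
        (barWord (S.vertexLetters r p v.dart) (S.valence v.dart * r v.dart)) =
      ∑ v : S.Vertex with S.Conn r p v.dart ∧ S.Interior v.dart,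
        ∑ j ∈ Finset.range (S.valence v.dart), w (S.toLoop r p (S.turn r (S.rot^[j] v.dart))) :=
    Finset.sum_congr rfl fun v hv => hVi v (Finset.mem_filter.1 hv).2.2
  have hB : ∑ v : S.Vertex with S.Conn r p v.dart ∧ ¬ S.Interior v.dart,
      evalChain (coboundary₁₂ w) (barWord (S.vertexLetters r p v.dart) (S.valence v.dart)) =
      (∑ v : S.Vertex with S.Conn r p v.dart ∧ ¬ S.Interior v.dart,
        ∑ j ∈ Finset.range (S.valence v.dart), w (S.toLoop r p (S.turn r (S.rot^[j] v.dart))))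
      - ∑ v : S.Vertex with S.Conn r p v.dart ∧ ¬ S.Interior v.dart,
        w (S.toLoop r p (S.link r v.dart)) := by
    rw [← Finset.sum_sub_distrib]
    exact Finset.sum_congr rfl fun v _ => hVb v
  rw [hI, hB]
  linarith

end PolygonSurface

section RelativeCohomology

open groupCohomology

variable {G : Type} [Group G] {I : Type} (A : Rep.{0} ℝ G) (S : I → Subgroup G)

/-- The relative 1-cocycles of the group pair `(G, S)` with coefficients in `A`: the degree-one
cocycles of the cone of the restriction map from the cochains of `G` to the product of the
cochains of the `S i`. Explicitly these are the pairs `(u, X)` of a 1-cocycle `u` of `G` and a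
family of elements `X i` of `A` such that the restriction of `u` to `S i` is the coboundary
of `X i`. -/
def relCocycles₁ : Submodule ℝ ((G → A) × (I → A)) where
  carrier := {x | x.1 ∈ cocycles₁ A ∧ ∀ i, ∀ h ∈ S i, x.1 h = A.ρ h (x.2 i) - x.2 i}
  zero_mem' := by
    refine ⟨zero_mem _, fun i h _ => ?_⟩
    simp
  add_mem' := by
    intro x y hx hy
    refine ⟨add_mem hx.1 hy.1, fun i h hh => ?_⟩
    change x.1 h + y.1 h = A.ρ h (x.2 i + y.2 i) - (x.2 i + y.2 i)
    rw [hx.2 i h hh, hy.2 i h hh, map_add]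
    abel
  smul_mem' := by
    intro c x hx
    refine ⟨Submodule.smul_mem _ c hx.1, fun i h hh => ?_⟩
    change c • x.1 h = A.ρ h (c • x.2 i) - c • x.2 i
    rw [hx.2 i h hh, map_smul, smul_sub]

/-- The 1-cocycle of `G` underlying a relative 1-cocycle. -/
def relCocycles₁.toCocycle : relCocycles₁ A S →ₗ[ℝ] cocycles₁ A where
  toFun x := ⟨x.1.1, x.2.1⟩
  map_add' _ _ := rfl
  map_smul' _ _ := rfl

/-- The relative coboundary of an element `Y` of `A`: the 1-cocycle `g ↦ g • Y - Y` together
with the constant family `Y`. -/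
noncomputable def relCoboundary : A →ₗ[ℝ] relCocycles₁ A S where
  toFun Y := ⟨((d₀₁ A).hom Y, fun _ => Y), d₀₁_apply_mem_cocycles₁ Y, fun _ _ _ => rfl⟩
  map_add' Y Z := Subtype.ext (Prod.ext (map_add (d₀₁ A).hom Y Z) rfl)
  map_smul' c Y := Subtype.ext (Prod.ext (map_smul (d₀₁ A).hom c Y) rfl)

/-- The relative cohomology `H¹(G, S; A)` of the group pair `(G, S)`. -/
abbrev RelH1 : Type := relCocycles₁ A S ⧸ LinearMap.range (relCoboundary A S)

/-- The natural map from `H¹(G, S; A)` to `H¹(G; A)`, which forgets the family `X`. -/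
noncomputable def RelH1.toH1 : RelH1 A S →ₗ[ℝ] H1 A :=
  (LinearMap.range (relCoboundary A S)).liftQ
    ((H1π A).hom ∘ₗ relCocycles₁.toCocycle A S) (by
      rintro _ ⟨Y, rfl⟩
      exact (H1π_eq_zero_iff _).2 ⟨Y, rfl⟩)

/-- The parabolic cohomology `H¹_par(G, S; A)` of the group pair `(G, S)`: the image of the
relative cohomology `H¹(G, S; A)` in `H¹(G; A)`. -/
noncomputable def parH1 : Submodule ℝ (H1 A) := LinearMap.range (RelH1.toH1 A S)

variable {A S} in
/-- The relative 1-cocycle `x` represents the class `a` of `H¹(G; A)`. -/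
def Represents (x : relCocycles₁ A S) (a : H1 A) : Prop :=
  H1π A (relCocycles₁.toCocycle A S x) = a

theorem exists_of_mem_parH1 {a : H1 A} (ha : a ∈ parH1 A S) :
    ∃ x : relCocycles₁ A S, Represents x a := by
  obtain ⟨y, rfl⟩ := ha
  obtain ⟨x, rfl⟩ := Submodule.Quotient.mk_surjective _ y
  exact ⟨x, rfl⟩

theorem mem_parH1 (x : relCocycles₁ A S) : H1π A (relCocycles₁.toCocycle A S x) ∈ parH1 A S :=
  ⟨Submodule.Quotient.mk x, rfl⟩

/-- Enlarging the family of subgroups makes the parabolic cohomology smaller. -/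
theorem parH1_mono {J : Type} (T : J → Subgroup G) (f : I → J) (hf : ∀ i, T (f i) = S i) :
    parH1 A T ≤ parH1 A S := by
  intro a ha
  obtain ⟨x, rfl⟩ := exists_of_mem_parH1 A T ha
  have hx : ∀ i, ∀ h ∈ S i, x.1.1 h = A.ρ h (x.1.2 (f i)) - x.1.2 (f i) :=
    fun i h hh => x.2.2 (f i) h ((hf i).symm ▸ hh)
  exact mem_parH1 A S ⟨(x.1.1, fun i => x.1.2 (f i)), x.2.1, hx⟩

end RelativeCohomology

theorem evalChain_sub {G : Type} (φ ψ : G → G → ℝ) (c : BarChain₂ G) :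
    evalChain (fun a b => φ a b - ψ a b) c = evalChain φ c - evalChain ψ c := by
  simp only [evalChain, Finsupp.linearCombination_apply, smul_eq_mul, mul_sub]
  exact Finsupp.sum_sub

theorem evalChain_neg {G : Type} (φ : G → G → ℝ) (c : BarChain₂ G) :
    evalChain (fun a b => - φ a b) c = - evalChain φ c := by
  have := evalChain_sub (fun _ _ => 0) φ c
  simp only [zero_sub] at this
  rw [this]
  simp [evalChain, Finsupp.linearCombination_apply]

/-- A compact oriented 2-orbifold with cone singularities, possibly with boundary: a polygon
surface with the order of the origin of each side. The order is `1` at a regular point and at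
least `2` at a cone point. The order depends only on the vertex; at boundary vertices it has no
meaning and is never used. -/
structure ConeOrbifold extends PolygonSurface where
  order : Dart → ℕ
  order_pos : ∀ d, 0 < order d
  order_rot : ∀ d, glue d ≠ d → order (next (glue d)) = order d

namespace ConeOrbifold

open groupCohomology

variable (O : ConeOrbifold)

/-- The orbifold fundamental group. -/
abbrev Gamma (p : O.Dart) : Type := O.Pi1 O.order p

/-- The orbifold is connected. -/
def Connected : Prop := ∀ p d : O.Dart, O.Conn O.order p d

open Classical in
/-- The orbifold Euler characteristic of the component of `p`: the number of vertices minus the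
number of edges plus the number of polygons, minus `1 - 1 / r` for each cone point of order `r`.
There are as many boundary vertices as boundary sides, and interior edges are pairs of sides. -/
noncomputable def eulerChar (p : O.Dart) : ℚ :=
  ((Finset.univ.filter fun v : O.Vertex => O.Conn O.order p v.dart ∧ O.Interior v.dart).card
    + (Finset.univ.filter fun d : O.Dart => O.Conn O.order p d ∧ O.glue d = d).card)
  - ((Finset.univ.filter fun d : O.Dart => O.Conn O.order p d ∧ O.glue d ≠ d).card / 2
    + (Finset.univ.filter fun d : O.Dart => O.Conn O.order p d ∧ O.glue d = d).card)
  + (Finset.univ.filter fun f : O.Face => O.Conn O.order p f.dart).card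
  - ∑ v : O.Vertex with O.Conn O.order p v.dart ∧ O.Interior v.dart, (1 - 1 / O.order v.dart : ℚ)

/-- The boundary components of the component of `p`. -/
def BoundaryComponent (p : O.Dart) : Type :=
  {v : O.Vertex // O.Conn O.order p v.dart ∧ ¬ O.Interior v.dart}

open Classical in
noncomputable instance fintypeBoundaryComponent (p : O.Dart) :
    Fintype (O.BoundaryComponent p) :=
  inferInstanceAs (Fintype {v : O.Vertex // O.Conn O.order p v.dart ∧ ¬ O.Interior v.dart})

/-- The boundary component `v` as an element of the fundamental group, in the boundary
orientation. -/
noncomputable def boundaryLoop (p : O.Dart) (v : O.BoundaryComponent p) : O.Gamma p :=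
  O.toLoop O.order p (O.link O.order v.1.dart)

/-- The family `∂Γ` of cyclic subgroups generated by the boundary components. -/
noncomputable def boundarySubgroup (p : O.Dart) (v : O.BoundaryComponent p) :
    Subgroup (O.Gamma p) :=
  Subgroup.zpowers (O.boundaryLoop p v)

/-- The boundary of the fundamental chain is the sum of the boundary loops. -/
theorem evalChain_fundamentalChain (p : O.Dart) (w : O.Gamma p → ℝ) (hw : w 1 = 0) :
    evalChain (coboundary₁₂ w) (O.fundamentalChain O.order p) =
      ∑ v : O.BoundaryComponent p, w (O.boundaryLoop p v) := by
  classical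
  rw [O.toPolygonSurface.evalChain_fundamentalChain O.order p O.order_pos w hw]
  exact Finset.sum_subtype (p := fun v : O.Vertex => O.Conn O.order p v.dart ∧ ¬ O.Interior v.dart)
    _ (fun v => by simp) fun v => w (O.toLoop O.order p (O.link O.order v.dart))

variable {O} {p : O.Dart} {A : Rep.{0} ℝ (O.Gamma p)}

/-- The pairing of a relative 1-cocycle `(u, X)` of `(Γ, ∂Γ)` with a 1-cocycle `v` of `Γ`: the cup
product, formed with the bilinear form `B`, evaluated on the relative fundamental class. On the
chain `[a | b]` the cup product is `B (u a) (a • v b)`, and the boundary loops contribute `B (X z)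
(v z)`. -/
noncomputable def pairing (B : A →ₗ[ℝ] A →ₗ[ℝ] ℝ) (x : relCocycles₁ A (O.boundarySubgroup p))
    (v : cocycles₁ A) : ℝ :=
  evalChain (fun a b => B (x.1.1 a) (A.ρ a (v b))) (O.fundamentalChain O.order p)
    - ∑ z, B (x.1.2 z) (v (O.boundaryLoop p z))

theorem cocycle_mul (u : cocycles₁ A) (a b : O.Gamma p) : u (a * b) = A.ρ a (u b) + u a :=
  (mem_cocycles₁_iff u.1).1 u.2 a b

theorem pairing_sub_left (B : A →ₗ[ℝ] A →ₗ[ℝ] ℝ) (x y : relCocycles₁ A (O.boundarySubgroup p))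
    (v : cocycles₁ A) : pairing B (x - y) v = pairing B x v - pairing B y v := by
  have e1 : ∀ a, (x - y).1.1 a = x.1.1 a - y.1.1 a := fun _ => rfl
  have e2 : ∀ z, (x - y).1.2 z = x.1.2 z - y.1.2 z := fun _ => rfl
  simp only [pairing, e1, e2, map_sub, LinearMap.sub_apply, evalChain_sub, Finset.sum_sub_distrib]
  ring

theorem pairing_sub_right (B : A →ₗ[ℝ] A →ₗ[ℝ] ℝ) (x : relCocycles₁ A (O.boundarySubgroup p))
    (v w : cocycles₁ A) : pairing B x (v - w) = pairing B x v - pairing B x w := by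
  have e1 : ∀ a, (v - w) a = v a - w a := fun _ => rfl
  simp only [pairing, e1, map_sub, evalChain_sub, Finset.sum_sub_distrib]
  ring

/-- The pairing vanishes if `u` is a coboundary and `v` is parabolic. -/
theorem pairing_coboundary_left (B : A →ₗ[ℝ] A →ₗ[ℝ] ℝ)
    (hB : ∀ g a b, B (A.ρ g a) (A.ρ g b) = B a b)
    (x y : relCocycles₁ A (O.boundarySubgroup p)) (hx : x.1.1 ∈ coboundaries₁ A) :
    pairing B x (relCocycles₁.toCocycle A _ y) = 0 := by
  obtain ⟨Y, hY⟩ := hx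
  have hu : ∀ a, x.1.1 a = A.ρ a Y - Y := fun a => (congrFun hY a).symm
  set v := relCocycles₁.toCocycle A _ y
  have hv : ∀ z, ∀ h ∈ O.boundarySubgroup p z, v h = A.ρ h (y.1.2 z) - y.1.2 z := y.2.2
  have e : (fun a b => B (x.1.1 a) (A.ρ a (v b))) = coboundary₁₂ (fun g => B Y (v g)) := by
    funext a b
    simp only [coboundary₁₂, hu, map_sub, LinearMap.sub_apply, hB, cocycle_mul, map_add]
    ring
  have h1 : B Y (v 1) = 0 := by rw [cocycles₁_map_one, map_zero]
  rw [pairing, e, O.evalChain_fundamentalChain p _ h1, ← Finset.sum_sub_distrib]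
  refine Finset.sum_eq_zero fun z _ => ?_
  have hz : O.boundaryLoop p z ∈ O.boundarySubgroup p z := Subgroup.mem_zpowers _
  have h1 := x.2.2 z _ hz
  rw [hu] at h1
  have h3 := hB (O.boundaryLoop p z) (x.1.2 z - Y) (y.1.2 z)
  have h4 : A.ρ (O.boundaryLoop p z) (x.1.2 z - Y) = x.1.2 z - Y := by
    rw [map_sub, sub_eq_sub_iff_sub_eq_sub]
    exact h1.symm
  rw [h4] at h3
  rw [hv z _ hz, ← LinearMap.sub_apply, ← map_sub, ← neg_sub, map_neg, LinearMap.neg_apply,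
    map_sub, h3, sub_self, neg_zero]

/-- The pairing vanishes if `v` is a coboundary. -/
theorem pairing_coboundary_right (B : A →ₗ[ℝ] A →ₗ[ℝ] ℝ)
    (hB : ∀ g a b, B (A.ρ g a) (A.ρ g b) = B a b)
    (x : relCocycles₁ A (O.boundarySubgroup p)) (v : cocycles₁ A) (hv : v.1 ∈ coboundaries₁ A) :
    pairing B x v = 0 := by
  obtain ⟨Y, hY⟩ := hv
  have hu : ∀ a, v a = A.ρ a Y - Y := fun a => (congrFun hY a).symm
  have h0 : x.1.1 1 = 0 := cocycles₁_map_one (relCocycles₁.toCocycle A _ x)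
  have hm : ∀ a b, x.1.1 (a * b) = A.ρ a (x.1.1 b) + x.1.1 a :=
    cocycle_mul (relCocycles₁.toCocycle A _ x)
  have e : (fun a b => B (x.1.1 a) (A.ρ a (v b))) =
      fun a b => - coboundary₁₂ (fun g => B (x.1.1 g) (A.ρ g Y)) a b := by
    funext a b
    simp only [coboundary₁₂, hu, map_sub, map_mul, Module.End.mul_apply, LinearMap.add_apply, hB,
      hm, map_add]
    ring
  have h1 : B (x.1.1 1) (A.ρ 1 Y) = 0 := by rw [h0, map_zero, LinearMap.zero_apply]
  rw [pairing, e, evalChain_neg, O.evalChain_fundamentalChain p _ h1,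
    ← Finset.sum_neg_distrib, ← Finset.sum_sub_distrib]
  refine Finset.sum_eq_zero fun z _ => ?_
  have hz : O.boundaryLoop p z ∈ O.boundarySubgroup p z := Subgroup.mem_zpowers _
  rw [x.2.2 z _ hz, hu, map_sub, map_sub, LinearMap.sub_apply, hB]
  ring

/-- The pairing on the parabolic cohomology `H¹_par(Γ, ∂Γ; A)` that is induced by the cup product
and the relative fundamental class. It does not depend on the representatives, see the next
theorem. -/
noncomputable def omega (B : A →ₗ[ℝ] A →ₗ[ℝ] ℝ) (a b : parH1 A (O.boundarySubgroup p)) : ℝ :=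
  pairing B (exists_of_mem_parH1 A _ a.2).choose
    (relCocycles₁.toCocycle A _ (exists_of_mem_parH1 A _ b.2).choose)

/-- The pairing on the parabolic cohomology can be computed with any representatives. -/
theorem omega_eq_pairing (B : A →ₗ[ℝ] A →ₗ[ℝ] ℝ)
    (hB : ∀ g a b, B (A.ρ g a) (A.ρ g b) = B a b)
    (a b : parH1 A (O.boundarySubgroup p)) (x y : relCocycles₁ A (O.boundarySubgroup p))
    (hx : Represents x a.1) (hy : Represents y b.1) :
    omega B a b = pairing B x (relCocycles₁.toCocycle A _ y) := by
  have ha := (exists_of_mem_parH1 A _ a.2).choose_spec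
  have hb := (exists_of_mem_parH1 A _ b.2).choose_spec
  rw [omega]
  set x' := (exists_of_mem_parH1 A _ a.2).choose
  set y' := (exists_of_mem_parH1 A _ b.2).choose
  have h1 : (x' - x).1.1 ∈ coboundaries₁ A := (H1π_eq_iff _ _).1 (ha.trans hx.symm)
  have h2 : (relCocycles₁.toCocycle A _ y' - relCocycles₁.toCocycle A _ y).1 ∈ coboundaries₁ A :=
    (H1π_eq_iff _ _).1 (hb.trans hy.symm)
  have h3 := pairing_coboundary_left B hB (x' - x) y' h1
  have h4 := pairing_coboundary_right B hB x _ h2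
  rw [pairing_sub_left] at h3
  rw [pairing_sub_right] at h4
  linarith

end ConeOrbifold

section Coefficients

variable (n : ℕ)

/-- The group `PSL_n(ℝ)`. -/
abbrev PSL : Type := Matrix.ProjectiveSpecialLinearGroup (Fin n) ℝ

/-- The Lie algebra of traceless real matrices. -/
abbrev slAlg : Type := LieAlgebra.SpecialLinear.sl (Fin n) ℝ

/-- The adjoint action of `SL_n(ℝ)`, by conjugation. -/
def conjSL : Matrix.SpecialLinearGroup (Fin n) ℝ →* Module.End ℝ (slAlg n) where
  toFun g :=
    { toFun := fun X => ⟨g.1 * X.1 * (g⁻¹).1, by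
        have h : X.1.trace = 0 := X.2
        have e : (g⁻¹).1 * g.1 = 1 := congrArg Subtype.val (inv_mul_cancel g)
        change (g.1 * X.1 * (g⁻¹).1).trace = 0
        rw [Matrix.trace_mul_comm, ← mul_assoc, e, one_mul, h]⟩
      map_add' := fun X Y => Subtype.ext (by
        change g.1 * (X.1 + Y.1) * (g⁻¹).1 = g.1 * X.1 * (g⁻¹).1 + g.1 * Y.1 * (g⁻¹).1
        rw [mul_add, add_mul])
      map_smul' := fun c X => Subtype.ext (by
        change g.1 * (c • X.1) * (g⁻¹).1 = c • (g.1 * X.1 * (g⁻¹).1)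
        rw [mul_smul_comm, smul_mul_assoc]) }
  map_one' := LinearMap.ext fun X => Subtype.ext (by
    change (1 : Matrix (Fin n) (Fin n) ℝ) * X.1 *
      ((1 : Matrix.SpecialLinearGroup (Fin n) ℝ)⁻¹).1 = X.1
    rw [inv_one]
    change 1 * X.1 * 1 = X.1
    rw [one_mul, mul_one])
  map_mul' g h := LinearMap.ext fun X => Subtype.ext (by
    change (g * h).1 * X.1 * ((g * h)⁻¹).1 = g.1 * (h.1 * X.1 * (h⁻¹).1) * (g⁻¹).1
    rw [mul_inv_rev]
    change g.1 * h.1 * X.1 * ((h⁻¹).1 * (g⁻¹).1) = _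
    simp only [mul_assoc])

theorem conjSL_center (g : Matrix.SpecialLinearGroup (Fin n) ℝ)
    (hg : g ∈ Subgroup.center (Matrix.SpecialLinearGroup (Fin n) ℝ)) : conjSL n g = 1 := by
  obtain ⟨r, -, hr⟩ := Matrix.SpecialLinearGroup.mem_center_iff.1 hg
  have e : g.1 * (g⁻¹).1 = 1 := congrArg Subtype.val (mul_inv_cancel g)
  refine LinearMap.ext fun X => Subtype.ext ?_
  change g.1 * X.1 * (g⁻¹).1 = X.1
  have hc : g.1 * X.1 = X.1 * g.1 := by
    have hr' : Matrix.scalar (Fin n) r = g.1 := hr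
    rw [← hr']
    exact Matrix.scalar_commute r (fun r' => mul_comm r r') X.1
  rw [hc, mul_assoc, e, mul_one]

/-- The adjoint action of `PSL_n(ℝ)` on its Lie algebra. -/
def adPSL : PSL n →* Module.End ℝ (slAlg n) :=
  QuotientGroup.lift _ (conjSL n) (conjSL_center n)

variable {n}

/-- The Lie algebra of `PSL_n(ℝ)` as a representation of `G`, through `Ad ∘ ρ`. -/
abbrev adRep {G : Type} [Group G] (ρ : G →* PSL n) : Rep.{0} ℝ G :=
  Rep.of ((adPSL n).comp ρ : Representation ℝ G (slAlg n))

variable (n) in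
/-- The form `Tr(X Y)`. -/
def traceForm : slAlg n →ₗ[ℝ] slAlg n →ₗ[ℝ] ℝ :=
  LinearMap.mk₂ ℝ (fun X Y => (X.1 * Y.1).trace)
    (fun X X' Y => by
      change ((X.1 + X'.1) * Y.1).trace = _
      rw [add_mul, Matrix.trace_add])
    (fun c X Y => by
      change ((c • X.1) * Y.1).trace = _
      rw [smul_mul_assoc, Matrix.trace_smul])
    (fun X Y Y' => by
      change (X.1 * (Y.1 + Y'.1)).trace = _
      rw [mul_add, Matrix.trace_add])
    (fun c X Y => by
      change (X.1 * (c • Y.1)).trace = _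
      rw [mul_smul_comm, Matrix.trace_smul])

/-- The trace form is invariant. -/
theorem traceForm_ad (g : PSL n) (X Y : slAlg n) :
    traceForm n (adPSL n g X) (adPSL n g Y) = traceForm n X Y := by
  obtain ⟨g, rfl⟩ := QuotientGroup.mk_surjective g
  change (g.1 * X.1 * (g⁻¹).1 * (g.1 * Y.1 * (g⁻¹).1)).trace = (X.1 * Y.1).trace
  have e : (g⁻¹).1 * g.1 = 1 := congrArg Subtype.val (inv_mul_cancel g)
  have e2 : g.1 * X.1 * (g⁻¹).1 * (g.1 * Y.1 * (g⁻¹).1) = g.1 * (X.1 * Y.1 * (g⁻¹).1) := by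
    rw [mul_assoc (g.1 * X.1), ← mul_assoc (g⁻¹).1, ← mul_assoc (g⁻¹).1, e, one_mul]
    simp only [mul_assoc]
  rw [e2, Matrix.trace_mul_comm, mul_assoc, e, mul_one]

/-- No proper nonzero subspace of `ℝⁿ` is invariant under the matrices that represent `ρ γ`. -/
def IsIrreducibleRep {G : Type} [Group G] (ρ : G →* PSL n) : Prop :=
  ∀ W : Submodule ℝ (Fin n → ℝ),
    (∀ (γ : G) (g : Matrix.SpecialLinearGroup (Fin n) ℝ), (QuotientGroup.mk g : PSL n) = ρ γ →
      ∀ x ∈ W, g.1.mulVec x ∈ W) → W = ⊥ ∨ W = ⊤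

end Coefficients

namespace ConeOrbifold

open groupCohomology

variable (O : ConeOrbifold) {n : ℕ}

/-- The set `Hom_s^𝓑(Γ, PSL_n(ℝ))` of irreducible representations with trivial centralizer that
map each boundary component into the conjugacy class prescribed by `𝓑`. -/
structure HomSB (p : O.Dart) (𝓑 : O.BoundaryComponent p → ConjClasses (PSL n))
    (ρ : O.Gamma p →* PSL n) : Prop where
  irreducible : IsIrreducibleRep ρ
  centralizer : Subgroup.centralizer (ρ.range : Set (PSL n)) = ⊥
  boundary : ∀ z, ConjClasses.mk (ρ (O.boundaryLoop p z)) = 𝓑 z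

variable {O} in
/-- The Atiyah–Bott–Goldman form `ω^O` on `H¹_par(Γ, ∂Γ; 𝔤)`, given by the cup product with the
trace form and the relative fundamental class. -/
noncomputable def omegaABG {p : O.Dart} (ρ : O.Gamma p →* PSL n)
    (a b : parH1 (adRep ρ) (O.boundarySubgroup p)) : ℝ :=
  omega (A := adRep ρ) (traceForm n) a b

variable {O} in
/-- The Atiyah–Bott–Goldman form computed with arbitrary representatives. -/
theorem omegaABG_eq {p : O.Dart} (ρ : O.Gamma p →* PSL n)
    (a b : parH1 (adRep ρ) (O.boundarySubgroup p))
    (x y : relCocycles₁ (adRep ρ) (O.boundarySubgroup p))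
    (hx : Represents x a.1) (hy : Represents y b.1) :
    omegaABG ρ a b = pairing (A := adRep ρ) (traceForm n) x (relCocycles₁.toCocycle _ _ y) :=
  omega_eq_pairing _ (fun g X Y => traceForm_ad (ρ g) X Y) a b x y hx hy

/-- The orbifold cut open along the sides in `C`. -/
noncomputable def cut (C : Set O.Dart) : ConeOrbifold where
  toPolygonSurface := O.toPolygonSurface.cut C
  order := O.order
  order_pos := O.order_pos
  order_rot := by
    intro d hd
    by_cases h : d ∈ C ∨ O.glue d ∈ C
    · exact absurd (O.cut_glue_of_mem h) hd
    · rw [O.cut_glue_of_not_mem h] at hd ⊢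
      exact O.order_rot d hd

/-- The homomorphism from the orbifold fundamental group of a piece to that of the whole orbifold.
-/
noncomputable def inclusion (C : Set O.Dart) {p q : O.Dart}
    (h : O.pt O.order p ⟶ O.pt O.order q) : (O.cut C).Gamma q →* O.Gamma p :=
  O.toPolygonSurface.inclusion O.order C h

/-- The labels for the surface `X'` that remains when the cone points are removed. -/
def punctured (d : O.Dart) : ℕ := if O.order d = 1 then 1 else 0

/-- A path that runs along the directed sides `side 0`, …, `side len`. -/
structure Curve where
  len : ℕ
  side : Fin (len + 1) → O.Dart

namespace Curve

variable {O} (ξ : O.Curve)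

/-- The sides on which the curve runs. -/
def darts : Set O.Dart := Set.range ξ.side

/-- The sides that start at a vertex of the curve. -/
def vertexDarts : Set O.Dart :=
  {d | ∃ j, O.rot.SameCycle (ξ.side j) d ∨ O.rot.SameCycle (O.glue (ξ.side j)) d}

/-- The loop that runs along the curve on its left side; it is the boundary loop that arises when
the surface is cut open along the curve. For a simple closed curve it is freely homotopic to the
curve. For an arc between two cone points of order two it runs once around the arc and is the
product `s₁ s₂` of generators of the two isotropy groups. -/
noncomputable def loop (r : O.Dart → ℕ) :
    O.pt r (ξ.side 0) ⟶ O.pt r (ξ.side 0) :=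
  O.reglueHom r ξ.darts (ξ.side 0) ((O.toPolygonSurface.cut ξ.darts).link r (ξ.side 0))

/-- The curve is closed and simple and lies in the interior of the surface, away from the cone
points. -/
structure IsSimpleClosed : Prop where
  interior : ∀ j, O.Interior (ξ.side j)
  order_one : ∀ j, O.order (ξ.side j) = 1
  step : ∀ j, O.rot.SameCycle (O.glue (ξ.side j)) (ξ.side (j + 1))
  injective : ∀ i j, O.rot.SameCycle (ξ.side i) (ξ.side j) → i = j
  no_return : ∀ i j, ξ.side i ≠ O.glue (ξ.side j)

/-- The curve is not homotopic, in the surface with the cone points removed, to a point, to a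
boundary component or to a puncture, with either orientation. -/
structure IsEssential : Prop where
  not_point : ξ.loop O.punctured ≠ 𝟙 _
  not_peripheral : ∀ (d : O.Dart), (¬ O.Interior d ∨ O.order d ≠ 1) →
    ∀ f : O.pt O.punctured (ξ.side 0) ⟶ O.pt O.punctured d,
      ξ.loop O.punctured ≠ f ≫ O.link O.punctured d ≫ inv f ∧
      inv (ξ.loop O.punctured) ≠ f ≫ O.link O.punctured d ≫ inv f

/-- The curve is a full 1-suborbifold: an embedded arc that joins two distinct cone points of
order two and otherwise lies in the interior of the surface, away from the cone points. -/
structure IsFullOneSuborbifold : Prop where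
  interior : ∀ j, O.Interior (ξ.side j)
  interior_last : O.Interior (O.glue (ξ.side (Fin.last ξ.len)))
  step : ∀ j : Fin ξ.len,
    O.rot.SameCycle (O.glue (ξ.side j.castSucc)) (ξ.side j.succ)
  injective : ∀ i j, O.rot.SameCycle (ξ.side i) (ξ.side j) → i = j
  injective_last : ∀ j, ¬ O.rot.SameCycle (ξ.side j) (O.glue (ξ.side (Fin.last ξ.len)))
  order_first : O.order (ξ.side 0) = 2
  order_last : O.order (O.glue (ξ.side (Fin.last ξ.len))) = 2
  order_one : ∀ j : Fin ξ.len, O.order (ξ.side j.succ) = 1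

/-- The cyclic subgroup `⟨ξ⟩` of the orbifold fundamental group; for a full 1-suborbifold it is
`⟨s₁ s₂⟩`. -/
noncomputable def subgroup (p : O.Dart) : Subgroup (O.Gamma p) :=
  Subgroup.zpowers (O.toLoop O.order p (ξ.loop O.order))

end Curve

/-- Pairwise disjoint curves, each of which is an essential simple closed curve or a full
1-suborbifold. -/
structure CutSystem (m : ℕ) where
  curve : Fin m → O.Curve
  curve_type : ∀ i, ((curve i).IsSimpleClosed ∧ (curve i).IsEssential) ∨
    (curve i).IsFullOneSuborbifold
  disjoint : ∀ i j, i ≠ j → Disjoint (curve i).vertexDarts (curve j).vertexDarts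

variable {O}

/-- All sides on which the curves of the system run. -/
def CutSystem.darts {m : ℕ} (ξ : O.CutSystem m) : Set O.Dart := ⋃ i, (ξ.curve i).darts

/-- The family `𝒮 = ∂Γ ∪ {⟨ξ 1⟩, …, ⟨ξ m⟩}` of subgroups of `Γ`. -/
noncomputable def CutSystem.pair {m : ℕ} (ξ : O.CutSystem m) (p : O.Dart) :
    O.BoundaryComponent p ⊕ Fin m → Subgroup (O.Gamma p) :=
  Sum.elim (O.boundarySubgroup p) fun i => (ξ.curve i).subgroup p

/-- Parabolic classes relative to `𝒮` are parabolic classes relative to `∂Γ`. -/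
theorem CutSystem.parH1_le {m : ℕ} (ξ : O.CutSystem m) (p : O.Dart) (A : Rep.{0} ℝ (O.Gamma p)) :
    parH1 A (ξ.pair p) ≤ parH1 A (O.boundarySubgroup p) :=
  parH1_mono A _ _ Sum.inl fun _ => rfl

end ConeOrbifold

/-- The pullback `ι^*` from `H¹(G; 𝔤)` to `H¹(H; 𝔤)` along a homomorphism `ι`. -/
noncomputable def pullbackH1 {n : ℕ} {G H : Type} [Group G] [Group H] (ι : H →* G)
    (ρ : G →* PSL n) :
    groupCohomology.H1 (adRep ρ) →ₗ[ℝ] groupCohomology.H1 (adRep (ρ.comp ι)) :=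
  (groupCohomology.map ι (𝟙 (adRep (ρ.comp ι)) : Rep.res ι (adRep ρ) ⟶ adRep (ρ.comp ι)) 1).hom

/-! A cocycle `u` turns the linear action of Γ on 𝔤 into an affine one, Y ↦ g·Y - u(g)
(`affineAct`), and `u` is a coboundary on a subgroup exactly when that subgroup has a fixed point. A
family X of elements of 𝔤, one for each side, is a section over the base points of the fundamental
groupoid. Its failure to be parallel along a path, `twist`, is a groupoid cocycle cohomologous to
`u`.

Passing from u, v to their twists changes the cup product by the coboundary of an explicit cochain
(`cup_eq_twistCup_add`). Suppose that X and Y are parallel along all turns. Then the regions around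
vertices and along the boundary contribute nothing to the twisted cup product, the boundary terms of
the coboundary cancel against the correction Σ Tr(X_j v(z_j)), and the twist of a crossing is
determined by the twist of a side. What is left (`pairing_eq_sum_faces`) is a sum of terms attached
to single polygons and single sides, in which the gluing no longer occurs. Since cutting changes
only the gluing, additivity follows as soon as the same sections compute the form of the whole
orbifold and the forms of the pieces. They then also show that the restrictions to the pieces are
parabolic.

For this a section has to be flat around the vertices and also across the sides of the curves
(`IsFlat.cut`). Its existence (`CutSystem.exists_flat`) is where parabolicity relative to 𝒮 enters.
Boundary loops have fixed points by hypothesis, and loops around cone points have them by averaging.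
Along a simple closed curve, a fixed point of ⟨ξ⟩ is transported from side to side; the vertices met
are regular and give no obstruction. For a full 1-suborbifold, a fixed point Y of s₁s₂ satisfies s₁Y
= s₂Y, so the midpoint of Y and s₁Y is fixed by both involutions and can be transported along the
arc. Disjoint curves have disjoint sets of vertices, so these sections can be patched.

The paths that close up loops are chosen independently in the orbifold and in its pieces. They
differ by group elements (`exists_inclusion_toLoop`), whose effect on twists is the adjoint action,
and the trace form is invariant. -/

/-! ### Sums over orbits and evaluation on bar words. -/

/-- Summing over the orbits of a permutation that meet an invariant set is summing over that
set. -/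
theorem sum_orbits_filter {D M : Type} [Fintype D] [AddCommMonoid M] (σ : Equiv.Perm D)
    (P : D → Prop) [DecidablePred P] (hP : ∀ d, P d ↔ P (σ d)) (g : D → M)
    [Fintype (_root_.Quotient (Equiv.Perm.SameCycle.setoid σ))] :
    ∑ q : _root_.Quotient (Equiv.Perm.SameCycle.setoid σ) with P q.out,
      ∑ j ∈ Finset.range (Function.minimalPeriod σ q.out), g (σ^[j] q.out) =
    ∑ d with P d, g d := by
  have hit : ∀ (j : ℕ) (d : D), P (σ^[j] d) ↔ P d := by
    intro j
    induction j with
    | zero => exact fun d => Iff.rfl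
    | succ j ih => exact fun d => (ih (σ d)).trans (hP d).symm
  rw [Finset.sum_filter, Finset.sum_filter, ← sum_orbits σ]
  refine Finset.sum_congr rfl fun q _ => ?_
  simp only [hit]
  split_ifs with h
  · rfl
  · simp

/-- A sum over several periods. -/
theorem sum_range_mul_of_periodic {M : Type*} [AddCommMonoid M] (g : ℕ → M) (k m : ℕ)
    (hg : ∀ j, g (j + k) = g j) :
    ∑ j ∈ Finset.range (k * m), g j = m • ∑ j ∈ Finset.range k, g j := by
  induction m with
  | zero => simp
  | succ m ih =>
    have hg' : ∀ j, g (k * m + j) = g j := by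
      intro j
      rw [add_comm, mul_comm]
      exact (show Function.Periodic g k from hg).nat_mul m j
    rw [Nat.mul_succ, Finset.sum_range_add, ih, Finset.sum_congr rfl fun j _ => hg' j, succ_nsmul]

theorem evalChain_barWord_eq_sum {G : Type} [Group G] (φ : G → G → ℝ) (g : ℕ → G) (k : ℕ) :
    evalChain φ (barWord g k) =
      ∑ j ∈ Finset.range k, φ ((List.range j).map g).prod (g j) := by
  simp only [barWord, map_sum, evalChain_single]

/-! ### The affine action of a cocycle and the transgression of the cup product. -/

section Twist

open groupCohomology

variable {G D : Type} [Group G] {A : Rep.{0} ℝ G}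

theorem groupCohomology.cocycles₁_map_mul (u : cocycles₁ A) (a b : G) :
    u (a * b) = A.ρ a (u b) + u a :=
  (mem_cocycles₁_iff u.1).1 u.2 a b

/-- The affine action of `G` on `A` whose linear part is the given one and whose translation part
is the cocycle `-u`. -/
def affineAct (u : cocycles₁ A) (g : G) (Y : A) : A := A.ρ g Y - u g

theorem affineAct_apply (u : cocycles₁ A) (g : G) (Y : A) : affineAct u g Y = A.ρ g Y - u g := rfl

/-- The cocycle identity for `u` is precisely what makes these affine maps compose. -/
theorem affineAct_mul (u : cocycles₁ A) (g h : G) (Y : A) :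
    affineAct u (g * h) Y = affineAct u g (affineAct u h Y) := by
  simp only [affineAct_apply, cocycles₁_map_mul, map_mul, map_sub, sub_sub, Module.End.mul_apply]

theorem affineAct_one (u : cocycles₁ A) (Y : A) : affineAct u 1 Y = Y := by
  rw [affineAct_apply, cocycles₁_map_one, map_one, sub_zero]
  rfl

theorem affineAct_sub (u : cocycles₁ A) (g : G) (Y Z : A) :
    affineAct u g Y - affineAct u g Z = A.ρ g (Y - Z) := by
  rw [affineAct_apply, affineAct_apply, map_sub]
  abel

/-- The value of `u + δX` on a path from `a` to `b` with holonomy `g`. -/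
def twist (u : cocycles₁ A) (X : D → A) (a : D) (g : G) (b : D) : A := X a - affineAct u g (X b)

/-- Cocycle law in the groupoid: insert the transport of `X b` along `g` and use that the affine map
of `g` has linear part `A.ρ g`. -/
theorem twist_mul (u : cocycles₁ A) (X : D → A) (a b c : D) (g h : G) :
    twist u X a (g * h) c = twist u X a g b + A.ρ g (twist u X b h c) := by
  rw [twist, twist, twist, ← affineAct_sub u, affineAct_mul]
  abel

theorem twist_one (u : cocycles₁ A) (X : D → A) (a : D) : twist u X a 1 a = 0 := by
  rw [twist, affineAct_one, sub_self]

/-- The cochain whose coboundary relates the cup products of `u` and `v` and of `u + δX` and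
`v + δY`. -/
def transgression (B : A →ₗ[ℝ] A →ₗ[ℝ] ℝ) (u v : cocycles₁ A) (X Y : D → A) (a : D) (g : G)
    (b : D) : ℝ :=
  B (X a) (v g) - B (twist u X a g b) (A.ρ g (Y b))

/-- The cup product of `u + δX` and `v + δY`. -/
def twistCup (B : A →ₗ[ℝ] A →ₗ[ℝ] ℝ) (u v : cocycles₁ A) (X Y : D → A) (a : D) (g : G)
    (b : D) (h : G) (c : D) : ℝ :=
  B (twist u X a g b) (A.ρ g (twist v Y b h c))

variable (B : A →ₗ[ℝ] A →ₗ[ℝ] ℝ) (u v : cocycles₁ A) (X Y : D → A)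

theorem transgression_one (a : D) : transgression B u v X Y a 1 a = 0 := by
  rw [transgression, twist_one, cocycles₁_map_one]
  simp

/-- Write u = ũ - δX and v = ṽ - δY with ũ, ṽ the twists. Since v is a cocycle, the term linear in X
is the coboundary of B(X a, v g). Since ũ is a cocycle, the remaining term in Y is the coboundary of
-B(ũ g, g·Y b). Invariance of B moves the second letter's terms to the initial point. -/
theorem cup_eq_twistCup_add (hB : ∀ g a b, B (A.ρ g a) (A.ρ g b) = B a b)
    (a b c : D) (g h : G) :
    B (u g) (A.ρ g (v h)) = twistCup B u v X Y a g b h c + transgression B u v X Y a g b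
      + transgression B u v X Y b h c - transgression B u v X Y a (g * h) c := by
  have h1 : B (twist u X b h c) (A.ρ h (Y c)) =
      B (A.ρ g (twist u X b h c)) (A.ρ g (A.ρ h (Y c))) := (hB _ _ _).symm
  have h2 : B (X b) (v h) = B (A.ρ g (X b)) (A.ρ g (v h)) := (hB _ _ _).symm
  have h3 : u g = twist u X a g b + A.ρ g (X b) - X a := by
    rw [twist, affineAct_apply]; abel
  have h4 : twist v Y b h c = Y b - (A.ρ h (Y c) - v h) := rfl
  simp only [twistCup, transgression]
  rw [h1, h2, twist_mul u X a b c g h, cocycles₁_map_mul, h3,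
    h4, map_mul]
  simp only [Module.End.mul_apply, map_sub, map_add, LinearMap.add_apply, LinearMap.sub_apply]
  ring

/-- The cup product along a word whose `j`-th letter is a path from `e j` to `e (j + 1)`. -/
theorem evalChain_cup_barWord (hB : ∀ g a b, B (A.ρ g a) (A.ρ g b) = B a b)
    (e : ℕ → D) (g : ℕ → G) (k : ℕ) :
    evalChain (fun a b => B (u a) (A.ρ a (v b))) (barWord g k) =
      (∑ j ∈ Finset.range k,
        twistCup B u v X Y (e 0) ((List.range j).map g).prod (e j) (g j) (e (j + 1)))
      + (∑ j ∈ Finset.range k, transgression B u v X Y (e j) (g j) (e (j + 1)))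
      - transgression B u v X Y (e 0) ((List.range k).map g).prod (e k) := by
  rw [evalChain_barWord_eq_sum]
  induction k with
  | zero => simp [transgression_one]
  | succ k ih =>
    rw [Finset.sum_range_succ, Finset.sum_range_succ, Finset.sum_range_succ, ih,
      cup_eq_twistCup_add B u v X Y hB (e 0) (e k) (e (k + 1)), List.range_succ, List.map_append,
      List.prod_append]
    simp only [List.map_cons, List.map_nil, List.prod_cons, List.prod_nil, mul_one]
    ring

/-- By the cocycle law, being parallel along every letter implies being parallel along every initial
segment; this removes the twisted cup products of the words around vertices. -/
theorem twist_prod_eq_zero (e : ℕ → D) (g : ℕ → G)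
    (h : ∀ j, X (e j) = affineAct u (g j) (X (e (j + 1)))) (k : ℕ) :
    twist u X (e 0) ((List.range k).map g).prod (e k) = 0 := by
  induction k with
  | zero => exact twist_one u X _
  | succ k ih =>
    rw [List.range_succ, List.map_append, List.prod_append, List.map_singleton,
      List.prod_singleton, twist_mul u X (e 0) (e k), ih, zero_add, twist, ← h k, sub_self, map_zero]

end Twist


/-! ### The pairing as a sum over polygons and sides. -/

namespace PolygonSurface

variable (S : PolygonSurface) (r : S.Dart → ℕ) (p : S.Dart)

/-- The path along the side `d` as a loop at `p`. -/
noncomputable def sideLoop (d : S.Dart) : S.Pi1 r p := S.toLoop r p (S.side r d)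

/-- The path across the side `d` as a loop at `p`. -/
noncomputable def crossLoop (d : S.Dart) : S.Pi1 r p := S.toLoop r p (S.cross r d)

/-- The turn past the side `d` as a loop at `p`. -/
noncomputable def turnLoop (d : S.Dart) : S.Pi1 r p := S.toLoop r p (S.turn r d)

theorem turnLoop_eq (d : S.Dart) :
    S.turnLoop r p d = S.crossLoop r p d * S.sideLoop r p (S.glue d) :=
  S.toLoop_comp r p _ _

theorem crossLoop_mul_crossLoop_glue (d : S.Dart) :
    S.crossLoop r p d * S.crossLoop r p (S.glue d) = 1 := by
  refine (S.toLoop_comp r p _ _).symm.trans ?_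
  rw [S.gpd_glue r d (S.glue_glue d).symm]
  exact S.toLoop_eqToHom r p (S.glue_glue d).symm

end PolygonSurface

namespace ConeOrbifold

open groupCohomology

variable {O : ConeOrbifold} {p : O.Dart} {A : Rep.{0} ℝ (O.Gamma p)}

open Classical in
/-- The pairing is a sum over the polygons and their sides if the cocycles are normalized to vanish
on all turns. -/
theorem pairing_eq_sum_faces (B : A →ₗ[ℝ] A →ₗ[ℝ] ℝ)
    (hB : ∀ g a b, B (A.ρ g a) (A.ρ g b) = B a b)
    (x : relCocycles₁ A (O.boundarySubgroup p)) (v : cocycles₁ A) (X Y : O.Dart → A)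
    (hX : ∀ d, O.Conn O.order p d → X d = affineAct (relCocycles₁.toCocycle A _ x)
      (O.turnLoop O.order p d) (X (O.rot d)))
    (hY : ∀ d, O.Conn O.order p d → Y d = affineAct v (O.turnLoop O.order p d) (Y (O.rot d)))
    (hx : ∀ z, x.1.2 z = X z.1.dart) :
    pairing B x v =
      (∑ f : O.Face with O.Conn O.order p f.dart, ∑ j ∈ Finset.range (O.faceSize f),
        twistCup B (relCocycles₁.toCocycle A _ x) v X Y f.dart
          ((List.range j).map (O.faceLetters O.order p f.dart)).prod (O.next^[j] f.dart)
          (O.sideLoop O.order p (O.next^[j] f.dart)) (O.next^[j + 1] f.dart))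
      + (1 / 2) * ∑ d : O.Dart with O.Conn O.order p d,
        B (twist (relCocycles₁.toCocycle A _ x) X d (O.sideLoop O.order p d) (O.next d))
          (twist v Y d (O.sideLoop O.order p d) (O.next d)) := by
  set u := relCocycles₁.toCocycle A _ x with hu
  set P : O.Dart → Prop := fun d => O.Conn O.order p d with hP
  set σ := O.sideLoop O.order p
  set κ := O.crossLoop O.order p
  set τ := O.turnLoop O.order p
  set φ : O.Gamma p → O.Gamma p → ℝ := fun a b => B (u a) (A.ρ a (v b)) with hφ
  set s := transgression B u v X Y with hs
  have hPn : ∀ d, P d ↔ P (O.next d) := O.conn_next O.order p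
  have hPr : ∀ d, P d ↔ P (O.rot d) := O.conn_rot O.order p
  have hPg : ∀ d, P d ↔ P (O.glue d) := O.conn_glue O.order p
  have hsg : ∀ g : O.Dart → ℝ, ∑ d with P d, g (O.glue d) = ∑ d with P d, g d := by
    intro g
    refine Finset.sum_equiv O.glue (fun d => ?_) fun _ _ => rfl
    simpa using hPg d
  have hPr' : ∀ (j : ℕ) (d : O.Dart), P d → P (O.rot^[j] d) := by
    intro j
    induction j with
    | zero => exact fun d h => h
    | succ j ih => exact fun d h => ih _ ((hPr d).1 h)
  have hF : ∀ f : O.Face, evalChain φ (barWord (O.faceLetters O.order p f.dart) (O.faceSize f)) =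
      (∑ j ∈ Finset.range (O.faceSize f), twistCup B u v X Y f.dart
          ((List.range j).map (O.faceLetters O.order p f.dart)).prod (O.next^[j] f.dart)
          (σ (O.next^[j] f.dart)) (O.next^[j + 1] f.dart))
      + ∑ j ∈ Finset.range (O.faceSize f),
          (fun d => s d (σ d) (O.next d)) (O.next^[j] f.dart) := by
    intro f
    have h1 := evalChain_cup_barWord B u v X Y hB (fun j => O.next^[j] f.dart)
      (O.faceLetters O.order p f.dart) (O.faceSize f)
    have h2 : O.next^[O.faceSize f] f.dart = f.dart := Function.iterate_minimalPeriod
    beta_reduce at h1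
    -- The word around a polygon closes up with trivial product, so its final transgression term is
    -- that of a constant path and vanishes.
    rw [O.prod_faceLetters, h2] at h1
    refine h1.trans ?_
    change _ - transgression B u v X Y f.dart 1 f.dart = _
    rw [transgression_one, sub_zero]
    refine congrArg₂ (· + ·) rfl (Finset.sum_congr rfl fun j _ => ?_)
    rw [Function.iterate_succ_apply']
    rfl
  have hF' : ∑ f : O.Face with P f.dart, ∑ j ∈ Finset.range (O.faceSize f),
      (fun d => s d (σ d) (O.next d)) (O.next^[j] f.dart) =
      ∑ d with P d, s d (σ d) (O.next d) :=
    @sum_orbits_filter O.Dart ℝ _ _ O.next P _ hPn (fun d => s d (σ d) (O.next d))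
      (inferInstance : Fintype O.Face)
  have hκ : ∀ d, κ d * κ (O.glue d) = 1 := O.crossLoop_mul_crossLoop_glue O.order p
  have hτ : ∀ d, κ d * σ (O.glue d) = τ d := fun d => (O.turnLoop_eq O.order p d).symm
  -- Crossing `d` and crossing back compose to the identity, so no third transgression term remains;
  -- the factor 2 is compensated by the weight 1/2 in the chain.
  have hE : ∑ d with P d, φ (κ d) (κ (O.glue d)) =
      (∑ d with P d, twistCup B u v X Y d (κ d) (O.glue d) (κ (O.glue d)) d)
      + 2 * ∑ d with P d, s d (κ d) (O.glue d) := by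
    have h1 : ∀ d, φ (κ d) (κ (O.glue d)) =
        twistCup B u v X Y d (κ d) (O.glue d) (κ (O.glue d)) d
        + (s d (κ d) (O.glue d) + s (O.glue d) (κ (O.glue d)) (O.glue (O.glue d))) := by
      intro d
      rw [hφ]
      beta_reduce
      rw [cup_eq_twistCup_add B u v X Y hB d (O.glue d) d, hκ, transgression_one, O.glue_glue]
      ring
    have h2 : ∑ d with P d, s (O.glue d) (κ (O.glue d)) (O.glue (O.glue d)) =
        ∑ d with P d, s d (κ d) (O.glue d) := by
      rw [← hsg]
      simp only [O.glue_glue]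
    rw [Finset.sum_congr rfl fun d _ => h1 d, Finset.sum_add_distrib, Finset.sum_add_distrib, h2]
    ring
  have hT : ∑ d with P d, φ (κ d) (σ (O.glue d)) =
      (∑ d with P d, twistCup B u v X Y d (κ d) (O.glue d) (σ (O.glue d)) (O.rot d))
      + (∑ d with P d, s d (κ d) (O.glue d)) + (∑ d with P d, s d (σ d) (O.next d))
      - ∑ d with P d, s d (τ d) (O.rot d) := by
    have h1 : ∀ d, φ (κ d) (σ (O.glue d)) =
        twistCup B u v X Y d (κ d) (O.glue d) (σ (O.glue d)) (O.rot d) + s d (κ d) (O.glue d)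
        + s (O.glue d) (σ (O.glue d)) (O.next (O.glue d)) - s d (τ d) (O.rot d) := by
      intro d
      rw [← hτ]
      exact cup_eq_twistCup_add B u v X Y hB d (O.glue d) (O.rot d) _ _
    have h2 : ∑ d with P d, s (O.glue d) (σ (O.glue d)) (O.next (O.glue d)) =
        ∑ d with P d, s d (σ d) (O.next d) := hsg fun d => s d (σ d) (O.next d)
    rw [Finset.sum_congr rfl fun d _ => h1 d, Finset.sum_sub_distrib, Finset.sum_add_distrib,
      Finset.sum_add_distrib, h2]
  -- The first factor of each twisted cup product is the twist of an initial segment of turns, which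
  -- vanishes by flatness of `X`. Only transgression terms survive.
  have hV : ∀ d, P d → ∀ k, evalChain φ (barWord (O.vertexLetters O.order p d) k) =
      (∑ j ∈ Finset.range k, (fun d => s d (τ d) (O.rot d)) (O.rot^[j] d))
      - s d ((List.range k).map (O.vertexLetters O.order p d)).prod (O.rot^[k] d) := by
    intro d hd k
    have h1 := evalChain_cup_barWord B u v X Y hB (fun j => O.rot^[j] d)
      (O.vertexLetters O.order p d) k
    have h2 : ∀ j, X (O.rot^[j] d) = affineAct u (O.vertexLetters O.order p d j)
        (X (O.rot^[j + 1] d)) := by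
      intro j
      rw [Function.iterate_succ_apply']
      exact hX _ (hPr' j d hd)
    refine h1.trans ?_
    rw [Finset.sum_eq_zero, zero_add]
    · refine congrArg₂ (· - ·) (Finset.sum_congr rfl fun j _ => ?_) rfl
      beta_reduce
      rw [Function.iterate_succ_apply']
      rfl
    · intro j _
      rw [twistCup, twist_prod_eq_zero u X (fun j => O.rot^[j] d) _ h2]
      simp
  -- The word is trivial in Γ and passes the cycle `O.order` times, so the transgressions of the
  -- turns are repeated that often, which cancels the weight of the cone point.
  have hVi : ∀ q : O.Vertex, P q.dart → O.Interior q.dart → (1 / O.order q.dart : ℝ) *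
      evalChain φ (barWord (O.vertexLetters O.order p q.dart)
        (O.valence q.dart * O.order q.dart)) =
      ∑ j ∈ Finset.range (O.valence q.dart),
        (fun d => s d (τ d) (O.rot d)) (O.rot^[j] q.dart) := by
    intro q hq hqi
    have h1 : O.rot^[O.valence q.dart * O.order q.dart] q.dart = q.dart :=
      (Function.IsPeriodicPt.mul_const (O.iterate_valence q.dart) _ :
        Function.IsPeriodicPt O.rot _ _)
    rw [hV _ hq, O.prod_vertexLetters O.order p _ hqi, h1, hs, transgression_one, sub_zero,
      sum_range_mul_of_periodic, nsmul_eq_mul]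
    · have : (O.order q.dart : ℝ) ≠ 0 := by exact_mod_cast (O.order_pos q.dart).ne'
      field_simp
    · intro j
      beta_reduce
      rw [Function.iterate_add_apply, O.iterate_valence]
  -- On a boundary loop the product need not be trivial; as the twist of the loop is zero, its
  -- transgression reduces to the correction term in the definition of `pairing`.
  have hVb : ∀ q : O.Vertex, P q.dart →
      evalChain φ (barWord (O.vertexLetters O.order p q.dart) (O.valence q.dart)) =
      (∑ j ∈ Finset.range (O.valence q.dart),
        (fun d => s d (τ d) (O.rot d)) (O.rot^[j] q.dart))
      - B (X q.dart) (v (O.toLoop O.order p (O.link O.order q.dart))) := by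
    intro q hq
    have h2 : ∀ j, X (O.rot^[j] q.dart) = affineAct u (O.vertexLetters O.order p q.dart j)
        (X (O.rot^[j + 1] q.dart)) := by
      intro j
      rw [Function.iterate_succ_apply']
      exact hX _ (hPr' j _ hq)
    have h3 := twist_prod_eq_zero u X (fun j => O.rot^[j] q.dart) _ h2 (O.valence q.dart)
    change twist u X q.dart _ _ = 0 at h3
    rw [hV _ hq, O.toLoop_link, hs, transgression, h3]
    simp
  have hVsum : (∑ q : O.Vertex with P q.dart ∧ O.Interior q.dart,
        ∑ j ∈ Finset.range (O.valence q.dart),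
          (fun d => s d (τ d) (O.rot d)) (O.rot^[j] q.dart))
      + (∑ q : O.Vertex with P q.dart ∧ ¬ O.Interior q.dart,
        ∑ j ∈ Finset.range (O.valence q.dart),
          (fun d => s d (τ d) (O.rot d)) (O.rot^[j] q.dart))
      = ∑ d with P d, s d (τ d) (O.rot d) := by
    rw [← Finset.filter_filter, ← Finset.filter_filter, Finset.sum_filter_add_sum_filter_not]
    exact @sum_orbits_filter O.Dart ℝ _ _ O.rot P _ hPr (fun d => s d (τ d) (O.rot d))
      (inferInstance : Fintype O.Vertex)
  -- A turn is a crossing followed by a side, so flatness makes the twist of the crossing equal to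
  -- minus the transported twist of the side. Substituting this, the two-gon contributes -1/2 and
  -- the triangle +1 times the same value of `B`, and the crossing disappears.
  have hEd : ∀ d, P d → (1 / 2) * twistCup B u v X Y d (κ d) (O.glue d) (κ (O.glue d)) d
      - twistCup B u v X Y d (κ d) (O.glue d) (σ (O.glue d)) (O.rot d) =
      (1 / 2) * B (twist u X (O.glue d) (σ (O.glue d)) (O.next (O.glue d)))
          (twist v Y (O.glue d) (σ (O.glue d)) (O.next (O.glue d))) := by
    intro d hd
    have key : ∀ (w : cocycles₁ A) (Z : O.Dart → A), Z d = affineAct w (τ d) (Z (O.rot d)) →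
        twist w Z d (κ d) (O.glue d) =
          - A.ρ (κ d) (twist w Z (O.glue d) (σ (O.glue d)) (O.next (O.glue d))) ∧
        A.ρ (κ d) (twist w Z (O.glue d) (κ (O.glue d)) d) =
          - twist w Z d (κ d) (O.glue d) := by
      intro w Z hZ
      have h1 := twist_mul w Z d (O.glue d) (O.rot d) (κ d) (σ (O.glue d))
      have h2 := twist_mul w Z d (O.glue d) d (κ d) (κ (O.glue d))
      rw [hτ, twist, ← hZ, sub_self] at h1
      rw [hκ, twist_one] at h2
      exact ⟨eq_neg_of_add_eq_zero_left h1.symm, eq_neg_of_add_eq_zero_right h2.symm⟩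
    obtain ⟨h1, -⟩ := key u X (hX d hd)
    obtain ⟨h3, h4⟩ := key v Y (hY d hd)
    rw [twistCup, twistCup, h4, h3, h1]
    change _ - B _ (A.ρ (κ d) (twist v Y (O.glue d) (σ (O.glue d)) (O.next (O.glue d)))) = _
    simp only [map_neg, LinearMap.neg_apply, hB]
    ring
  have hEsum : (1 / 2) * (∑ d with P d, twistCup B u v X Y d (κ d) (O.glue d) (κ (O.glue d)) d)
      - (∑ d with P d, twistCup B u v X Y d (κ d) (O.glue d) (σ (O.glue d)) (O.rot d)) =
      (1 / 2) * ∑ d with P d,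
        B (twist u X d (σ d) (O.next d)) (twist v Y d (σ d) (O.next d)) := by
    rw [Finset.mul_sum, ← Finset.sum_sub_distrib,
      Finset.sum_congr rfl fun d hd => hEd d (Finset.mem_filter.1 hd).2, ← Finset.mul_sum]
    exact congrArg _ (hsg fun d => B (twist u X d (σ d) (O.next d)) (twist v Y d (σ d) (O.next d)))
  have hz : ∑ z, B (x.1.2 z) (v (O.boundaryLoop p z)) =
      ∑ q : O.Vertex with P q.dart ∧ ¬ O.Interior q.dart,
        B (X q.dart) (v (O.toLoop O.order p (O.link O.order q.dart))) := by
    rw [Finset.sum_congr rfl fun z _ => by rw [hx z]]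
    exact (Finset.sum_subtype (p := fun q : O.Vertex => P q.dart ∧ ¬ O.Interior q.dart)
      _ (fun q => by simp)
      fun q => B (X q.dart) (v (O.toLoop O.order p (O.link O.order q.dart)))).symm
  have hI : ∑ q : O.Vertex with P q.dart ∧ O.Interior q.dart, (1 / O.order q.dart : ℝ) *
      evalChain φ (barWord (O.vertexLetters O.order p q.dart)
        (O.valence q.dart * O.order q.dart)) = _ :=
    Finset.sum_congr rfl fun q hq =>
      hVi q (Finset.mem_filter.1 hq).2.1 (Finset.mem_filter.1 hq).2.2
  have hb : ∑ q : O.Vertex with P q.dart ∧ ¬ O.Interior q.dart,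
      evalChain φ (barWord (O.vertexLetters O.order p q.dart) (O.valence q.dart)) = _ :=
    (Finset.sum_congr rfl fun q hq => hVb q (Finset.mem_filter.1 hq).2.1).trans
      (Finset.sum_sub_distrib _ _)
  have h0 : pairing B x v = evalChain φ (O.fundamentalChain O.order p)
    - ∑ z, B (x.1.2 z) (v (O.boundaryLoop p z)) := rfl
  rw [h0, hz]
  simp only [PolygonSurface.fundamentalChain, map_sub, map_add, map_smul, map_sum, smul_eq_mul,
    evalChain_single]
  change (∑ f : O.Face with P f.dart, evalChain φ (barWord (O.faceLetters O.order p f.dart)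
      (O.faceSize f))) + (1 / 2) * (∑ d with P d, φ (κ d) (κ (O.glue d)))
    - (∑ d with P d, φ (κ d) (σ (O.glue d))) - _ - _ - _ = _
  rw [hI, hb, hE, hT, Finset.sum_congr rfl fun f _ => hF f, Finset.sum_add_distrib, hF']
  -- The transgressions of sides, crossings and turns each occur with total coefficient zero.
  linarith

end ConeOrbifold


/-! ### Words along orbits and flat sections on the cycles of a permutation. -/

section OrbitWord

open groupCohomology

variable {D G : Type} [Group G]

/-- The product of the letters `t` along the first `k` points of the orbit of `d`. -/
def orbitWord (σ : Equiv.Perm D) (t : D → G) (d : D) (k : ℕ) : G :=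
  ((List.range k).map fun j => t (σ^[j] d)).prod

variable (σ : Equiv.Perm D) (t : D → G)

theorem orbitWord_zero (d : D) : orbitWord σ t d 0 = 1 := rfl

theorem orbitWord_succ (d : D) (k : ℕ) :
    orbitWord σ t d (k + 1) = t d * orbitWord σ t (σ d) k := by
  rw [orbitWord, List.range_succ_eq_map, List.map_cons, List.prod_cons, List.map_map]
  rfl

theorem orbitWord_add (d : D) (m n : ℕ) :
    orbitWord σ t d (m + n) = orbitWord σ t d m * orbitWord σ t (σ^[m] d) n := by
  induction m generalizing d with
  | zero => rw [Nat.zero_add, orbitWord_zero, one_mul]; rfl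
  | succ m ih => rw [Nat.succ_add, orbitWord_succ, orbitWord_succ, ih, mul_assoc]; rfl

theorem orbitWord_mul (d : D) (k m : ℕ) (h : σ^[k] d = d) :
    orbitWord σ t d (k * m) = orbitWord σ t d k ^ m := by
  induction m with
  | zero => rw [Nat.mul_zero, pow_zero, orbitWord_zero]
  | succ m ih =>
    rw [Nat.mul_succ, add_comm, orbitWord_add, h, ih, pow_succ']

/-- A word along a closed path in an orbit is a power of the word around the whole orbit. -/
theorem exists_orbitWord_eq_pow (d : D) (n : ℕ) (h : σ^[n] d = d) :
    ∃ m, orbitWord σ t d n = orbitWord σ t d (Function.minimalPeriod σ d) ^ m := by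
  obtain ⟨m, rfl⟩ := Function.IsPeriodicPt.minimalPeriod_dvd (show Function.IsPeriodicPt σ n d from h)
  exact ⟨m, orbitWord_mul σ t d _ m Function.iterate_minimalPeriod⟩

variable {A : Rep.{0} ℝ G} (u : cocycles₁ A)

theorem affineAct_pow_of_fixed (g : G) (Y : A) (h : affineAct u g Y = Y) (m : ℕ) :
    affineAct u (g ^ m) Y = Y := by
  induction m with
  | zero => rw [pow_zero, affineAct_one]
  | succ m ih => rw [pow_succ, affineAct_mul, h, ih]

/-- A section that is flat along an orbit. -/
theorem flat_orbitWord (X : D → A) (d : D) (h : ∀ j, X (σ^[j] d) =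
    affineAct u (t (σ^[j] d)) (X (σ^[j + 1] d))) (k : ℕ) :
    X d = affineAct u (orbitWord σ t d k) (X (σ^[k] d)) := by
  induction k generalizing d with
  | zero => rw [orbitWord_zero, affineAct_one]; rfl
  | succ k ih =>
    rw [orbitWord_succ, affineAct_mul]
    exact (h 0).trans (congrArg (affineAct u (t d)) (ih (σ d) fun j => h (j + 1)))

theorem exists_iterate_of_sameCycle [Finite D] {a b : D} (h : σ.SameCycle a b) :
    ∃ n, σ^[n] a = b := by
  obtain ⟨i, -, hi⟩ := h.exists_pow_eq'
  exact ⟨i, by rw [Equiv.Perm.iterate_eq_pow, hi]⟩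

theorem sameCycle_iterate (a : D) (n : ℕ) : σ.SameCycle a (σ^[n] a) :=
  ⟨n, by rw [zpow_natCast, ← Equiv.Perm.iterate_eq_pow]⟩

/-- A point that is fixed by the holonomy around a cycle extends to a flat section on the cycle. -/
theorem exists_flat_on_cycle [Finite D] (d₀ : D) (Y : A)
    (hY : affineAct u (orbitWord σ t d₀ (Function.minimalPeriod σ d₀)) Y = Y) :
    ∃ X : D → A, X d₀ = Y ∧ ∀ d, σ.SameCycle d₀ d → X d = affineAct u (t d) (X (σ d)) := by
  classical
  have hret : ∀ n, σ^[n] d₀ = d₀ → affineAct u (orbitWord σ t d₀ n) Y = Y := by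
    intro n hn
    obtain ⟨m, hm⟩ := exists_orbitWord_eq_pow σ t d₀ n hn
    rw [hm]
    exact affineAct_pow_of_fixed u _ Y hY m
  -- Two routes from `d` to `d₀` differ by a closed route at `d₀`, whose word fixes `Y`; hence the
  -- transported value is independent of the route.
  have hle : ∀ d i j, σ^[i] d = d₀ → σ^[j] d = d₀ → i ≤ j →
      affineAct u (orbitWord σ t d i) Y = affineAct u (orbitWord σ t d j) Y := by
    intro d i j hi hj hij
    obtain ⟨n, rfl⟩ := Nat.exists_eq_add_of_le hij
    rw [add_comm, Function.iterate_add_apply, hi] at hj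
    rw [orbitWord_add, hi, affineAct_mul, hret n hj]
  have hind : ∀ d i j, σ^[i] d = d₀ → σ^[j] d = d₀ →
      affineAct u (orbitWord σ t d i) Y = affineAct u (orbitWord σ t d j) Y := by
    intro d i j hi hj
    rcases le_total i j with h | h
    · exact hle d i j hi hj h
    · exact (hle d j i hj hi h).symm
  have hX : ∀ d i, σ^[i] d = d₀ →
      (if h : ∃ j, σ^[j] d = d₀ then affineAct u (orbitWord σ t d h.choose) Y else Y) =
        affineAct u (orbitWord σ t d i) Y := by
    intro d i hi
    have h : ∃ j, σ^[j] d = d₀ := ⟨i, hi⟩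
    rw [dif_pos h]
    exact hind d _ i h.choose_spec hi
  refine ⟨fun d => if h : ∃ j, σ^[j] d = d₀ then affineAct u (orbitWord σ t d h.choose) Y else Y, ?_, ?_⟩
  · exact (hX d₀ 0 rfl).trans (affineAct_one u Y)
  · intro d hd
    have h1 : σ.SameCycle (σ d) d₀ := Equiv.Perm.sameCycle_apply_left.2 hd.symm
    obtain ⟨n, hn⟩ := exists_iterate_of_sameCycle σ h1
    exact (hX d (n + 1) hn).trans
      ((by rw [orbitWord_succ, affineAct_mul] :
        affineAct u (orbitWord σ t d (n + 1)) Y = affineAct u (t d) (affineAct u (orbitWord σ t (σ d) n) Y)).trans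
        (congrArg _ (hX (σ d) n hn).symm))

/-- If the holonomy around every cycle has a fixed point, then there is a flat section, and its
values at points in different cycles may be prescribed. -/
theorem exists_flat_of_prescribed [Finite D]
    (hfix : ∀ c : _root_.Quotient (Equiv.Perm.SameCycle.setoid σ), ∃ Y,
      affineAct u (orbitWord σ t c.out (Function.minimalPeriod σ c.out)) Y = Y)
    {ι : Type} (b : ι → D) (hb : ∀ i j, σ.SameCycle (b i) (b j) → i = j) (Y : ι → A)
    (hY : ∀ i, affineAct u (orbitWord σ t (b i) (Function.minimalPeriod σ (b i))) (Y i) = Y i) :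
    ∃ X : D → A, (∀ i, X (b i) = Y i) ∧ ∀ d, X d = affineAct u (t d) (X (σ d)) := by
  set q : D → _root_.Quotient (Equiv.Perm.SameCycle.setoid σ) := fun d => _root_.Quotient.mk _ d
  have hq : ∀ c d, q c = q d → σ.SameCycle c d := fun c d h => _root_.Quotient.exact h
  have h1 : ∀ c, ∃ X : D → A, (∀ i, q (b i) = c → X (b i) = Y i) ∧
      ∀ d, q d = c → X d = affineAct u (t d) (X (σ d)) := by
    intro c
    -- By `hb` a cycle contains at most one prescribed point. A cycle without any starts from the
    -- fixed point supplied by `hfix`.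
    by_cases hc : ∃ i, q (b i) = c
    · obtain ⟨i, rfl⟩ := hc
      obtain ⟨X, hX, hX'⟩ := exists_flat_on_cycle σ t u (b i) (Y i) (hY i)
      refine ⟨X, fun j hj => ?_, fun d hd => hX' d (hq _ _ hd.symm)⟩
      obtain rfl := hb _ _ (hq _ _ hj)
      exact hX
    · obtain ⟨Z, hZ⟩ := hfix c
      obtain ⟨X, -, hX'⟩ := exists_flat_on_cycle σ t u c.out Z hZ
      exact ⟨X, fun j hj => absurd ⟨j, hj⟩ hc,
        fun d hd => hX' d (hq _ _ ((_root_.Quotient.out_eq c).trans hd.symm))⟩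
  choose X hX hX' using h1
  refine ⟨fun d => X (q d) d, fun i => hX _ i rfl, fun d => ?_⟩
  have h2 : q (σ d) = q d :=
    _root_.Quotient.sound (Equiv.Perm.sameCycle_apply_left.2 (Equiv.Perm.SameCycle.refl σ d))
  beta_reduce
  rw [h2]
  exact hX' _ d rfl

end OrbitWord

/-! ### Fixed points for elements of finite order. -/

section AffineFixedPoints

open groupCohomology

variable {G : Type} [Group G] {A : Rep.{0} ℝ G} (u : cocycles₁ A)

/-- An element of finite order has a fixed point for every affine action. -/
theorem exists_affineAct_fixed_of_pow_eq_one (g : G) (n : ℕ) (hn : 0 < n) (hg : g ^ n = 1) :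
    ∃ Y, affineAct u g Y = Y := by
  have hn' : (n : ℝ) ≠ 0 := by exact_mod_cast hn.ne'
  -- The barycentre of the orbit of 0: an affine map preserves barycentres, and `g` permutes the
  -- orbit cyclically because `g ^ n = 1`.
  refine ⟨(1 / n : ℝ) • ∑ i ∈ Finset.range n, affineAct u (g ^ i) 0, ?_⟩
  -- The translation part is written as an average of `n` copies of itself, so that the affine map
  -- can be applied to each summand.
  have h1 : (1 / n : ℝ) • ∑ i ∈ Finset.range n, u g = u g := by
    rw [Finset.sum_const, Finset.card_range, ← Nat.cast_smul_eq_nsmul ℝ, smul_smul,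
      one_div_mul_cancel hn', one_smul]
  rw [affineAct_apply, map_smul, map_sum]
  nth_rewrite 1 [← h1]
  rw [← smul_sub, ← Finset.sum_sub_distrib]
  congr 1
  have h2 : ∀ i, A.ρ g (affineAct u (g ^ i) 0) - u g = affineAct u (g ^ (i + 1)) 0 := by
    intro i
    rw [pow_succ', affineAct_mul]
    rfl
  rw [Finset.sum_congr rfl fun i _ => h2 i]
  have h3 := Finset.sum_range_succ (fun i => affineAct u (g ^ i) 0) n
  rw [Finset.sum_range_succ', hg, pow_zero] at h3
  exact add_right_cancel h3

/-- Two involutions have a common fixed point if their product has a fixed point. -/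
theorem exists_affineAct_fixed_of_involutions (s₁ s₂ : G) (h₁ : s₁ * s₁ = 1) (h₂ : s₂ * s₂ = 1)
    (Y : A) (hY : affineAct u (s₁ * s₂) Y = Y) :
    ∃ Z, affineAct u s₁ Z = Z ∧ affineAct u s₂ Z = Z := by
  -- An involution exchanges `Y` with its image and so fixes their midpoint.
  have key : ∀ s : G, s * s = 1 → affineAct u s ((1 / 2 : ℝ) • (Y + affineAct u s Y)) =
      (1 / 2 : ℝ) • (Y + affineAct u s Y) := by
    intro s hs
    have h : affineAct u s (affineAct u s Y) = Y := by rw [← affineAct_mul, hs, affineAct_one]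
    have h' : A.ρ s (affineAct u s Y) = Y + u s := eq_add_of_sub_eq h
    rw [affineAct_apply, map_smul, map_add, h', affineAct_apply]
    module
  -- Apply s₁ to Y = s₁s₂Y: the two images of `Y` agree, and so do the two midpoints.
  have h : affineAct u s₁ Y = affineAct u s₂ Y := by
    conv_lhs => rw [← hY]
    rw [← affineAct_mul, ← mul_assoc, h₁, one_mul]
  refine ⟨(1 / 2 : ℝ) • (Y + affineAct u s₁ Y), key s₁ h₁, ?_⟩
  rw [h]
  exact key s₂ h₂

end AffineFixedPoints


/-! ### Boundary words of the cut surface, read in the original fundamental group. -/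

namespace PolygonSurface

variable (S : PolygonSurface) (r : S.Dart → ℕ) (p : S.Dart) (C : Set S.Dart)

/-- A path of the surface cut open along `C` as a loop of the original surface. -/
noncomputable def reglueLoop {a b : S.Dart} (f : (S.cut C).pt r a ⟶ (S.cut C).pt r b) :
    S.Pi1 r p :=
  S.toLoop r p (a := a) (b := b) ((S.reglue r C).map f)

theorem reglueLoop_comp {a b c : S.Dart} (f : (S.cut C).pt r a ⟶ (S.cut C).pt r b)
    (g : (S.cut C).pt r b ⟶ (S.cut C).pt r c) :
    S.reglueLoop r p C (f ≫ g) = S.reglueLoop r p C f * S.reglueLoop r p C g := by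
  refine Eq.trans ?_ (S.toLoop_comp r p _ _)
  exact congrArg _ ((S.reglue r C).map_comp f g)

theorem reglueLoop_eqToHom {a b : S.Dart} (h : a = b) :
    S.reglueLoop r p C (eqToHom (congrArg ((S.cut C).pt r) h)) = 1 := by
  subst h
  refine Eq.trans ?_ (S.toLoop_eqToHom r p (rfl : a = a))
  exact congrArg _ ((S.reglue r C).map_id _)

theorem reglueLoop_side (d : S.Dart) :
    S.reglueLoop r p C ((S.cut C).side r d) = S.sideLoop r p d :=
  congrArg (S.toLoop r p) (S.reglueFree_side r C d)

open Classical in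
/-- A turn of the surface cut open along `C` as a loop of the original surface. -/
noncomputable def cutTurnLoop (d : S.Dart) : S.Pi1 r p :=
  if d ∈ C ∨ S.glue d ∈ C then S.sideLoop r p d else S.turnLoop r p d

/-- At a side in the cut nothing is crossed, so the turn degenerates to the step along the side;
elsewhere the gluing is unchanged. -/
theorem reglueLoop_turn (d : S.Dart) :
    S.reglueLoop r p C ((S.cut C).turn r d) = S.cutTurnLoop r p C d := by
  refine (S.reglueLoop_comp r p C _ _).trans ?_
  by_cases h : d ∈ C ∨ S.glue d ∈ C
  · rw [cutTurnLoop, if_pos h]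
    refine (congrArg₂ (· * ·) ?_ (S.reglueLoop_side r p C _)).trans
      ((one_mul _).trans (congrArg _ (S.cut_glue_of_mem h)))
    exact (congrArg (S.toLoop r p) (S.reglueFree_cross_of_mem r C h)).trans
      (S.toLoop_eqToHom r p (S.cut_glue_of_mem h).symm)
  · rw [cutTurnLoop, if_neg h, turnLoop_eq]
    refine congrArg₂ (· * ·) ?_ ((S.reglueLoop_side r p C _).trans
      (congrArg _ (S.cut_glue_of_not_mem h)))
    refine (congrArg (S.toLoop r p) (S.reglueFree_cross_of_not_mem r C h)).trans ?_
    refine (S.toLoop_comp r p _ _).trans ?_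
    refine (congrArg₂ (· * ·) rfl (S.toLoop_eqToHom r p (S.cut_glue_of_not_mem h).symm)).trans ?_
    exact mul_one _

theorem reglueLoop_turns (k : ℕ) (d : S.Dart) :
    S.reglueLoop r p C (((S.cut C).proj r).map (FreeGpd.turns (S.cut C) k d)) =
      orbitWord (S.cut C).rot (S.cutTurnLoop r p C) d k := by
  induction k generalizing d with
  | zero => exact S.reglueLoop_eqToHom r p C rfl
  | succ k ih =>
    rw [orbitWord_succ, ← ih, ← reglueLoop_turn]
    refine Eq.trans ?_ (S.reglueLoop_comp r p C _ _)
    exact congrArg _ (((S.cut C).proj r).map_comp _ _)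

theorem reglueLoop_link (d : S.Dart) :
    S.reglueLoop r p C ((S.cut C).link r d) =
      orbitWord (S.cut C).rot (S.cutTurnLoop r p C) d
        (Function.minimalPeriod (S.cut C).rot d) := by
  refine (S.reglueLoop_comp r p C _ _).trans ?_
  refine (congr (congrArg _ (S.reglueLoop_turns r p C _ d))
    (S.reglueLoop_eqToHom r p C ((S.cut C).iterate_valence d))).trans ?_
  exact mul_one _

theorem toLoop_link_eq_orbitWord (d : S.Dart) :
    S.toLoop r p (S.link r d) =
      orbitWord S.rot (S.turnLoop r p) d (Function.minimalPeriod S.rot d) :=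
  S.toLoop_link r p d

/-- This is the relation at a vertex. It provides elements of finite order at cone points and
trivial holonomy at regular points. -/
theorem orbitWord_pow_eq_one (d : S.Dart) (hd : S.Interior d) :
    orbitWord S.rot (S.turnLoop r p) d (Function.minimalPeriod S.rot d) ^ r d = 1 := by
  rw [← orbitWord_mul S.rot _ d _ _ Function.iterate_minimalPeriod]
  exact S.prod_vertexLetters r p d hd

/-- Around a regular point every closed word of turns is trivial. -/
theorem orbitWord_eq_one (d : S.Dart) (hd : S.Interior d) (h1 : r d = 1) (n : ℕ)
    (hn : S.rot^[n] d = d) : orbitWord S.rot (S.turnLoop r p) d n = 1 := by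
  obtain ⟨m, hm⟩ := exists_orbitWord_eq_pow S.rot (S.turnLoop r p) d n hn
  have h := S.orbitWord_pow_eq_one r p d hd
  rw [h1, pow_one] at h
  rw [hm, h, one_pow]

/-- The boundary of the surface cut open along `C` leads from `d` to `e` along a path with
holonomy `g`. -/
def BoundaryPath (d e : S.Dart) (g : S.Pi1 r p) : Prop :=
  ∃ k, (S.cut C).rot^[k] d = e ∧ orbitWord (S.cut C).rot (S.cutTurnLoop r p C) d k = g

variable {S r p C}

theorem BoundaryPath.trans {a b c : S.Dart} {g h : S.Pi1 r p} (h₁ : S.BoundaryPath r p C a b g)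
    (h₂ : S.BoundaryPath r p C b c h) : S.BoundaryPath r p C a c (g * h) := by
  obtain ⟨k, hk, hk'⟩ := h₁
  obtain ⟨l, hl, hl'⟩ := h₂
  refine ⟨k + l, ?_, ?_⟩
  · rw [add_comm, Function.iterate_add_apply, hk, hl]
  · rw [orbitWord_add, hk, hk', hl']

theorem BoundaryPath.refl (a : S.Dart) : S.BoundaryPath r p C a a 1 := ⟨0, rfl, rfl⟩

theorem cut_rot_of_mem {d : S.Dart} (h : d ∈ C ∨ S.glue d ∈ C) :
    (S.cut C).rot d = S.next d :=
  congrArg S.next (S.cut_glue_of_mem h)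

theorem cut_rot_of_not_mem {d : S.Dart} (h : ¬ (d ∈ C ∨ S.glue d ∈ C)) :
    (S.cut C).rot d = S.rot d :=
  congrArg S.next (S.cut_glue_of_not_mem h)

theorem boundaryPath_of_forall_not_mem (n : ℕ) (d : S.Dart)
    (H : ∀ i < n, ¬ (S.rot^[i] d ∈ C ∨ S.glue (S.rot^[i] d) ∈ C)) :
    S.BoundaryPath r p C d (S.rot^[n] d) (orbitWord S.rot (S.turnLoop r p) d n) := by
  induction n generalizing d with
  | zero => exact BoundaryPath.refl d
  | succ n ih =>
    have h0 := H 0 n.succ_pos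
    have h1 := ih (S.rot d) fun i hi => H (i + 1) (Nat.succ_lt_succ hi)
    rw [orbitWord_succ]
    refine BoundaryPath.trans ⟨1, cut_rot_of_not_mem h0, ?_⟩ h1
    rw [orbitWord_succ, orbitWord_zero, mul_one, cutTurnLoop]
    exact if_neg h0

/-- After a side `f` on which the surface is cut, the boundary of the cut surface follows the next
vertex up to the next side `e` in the cut. -/
theorem exists_boundaryPath_of_mem {f e : S.Dart} (hf : f ∈ C ∨ S.glue f ∈ C)
    (hfe : S.rot.SameCycle (S.glue f) e)
    (H : ∀ c, S.rot.SameCycle (S.glue f) c → (c ∈ C ∨ S.glue c ∈ C) → c = e ∨ c = S.glue f) :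
    ∃ n, S.rot^[n] (S.glue f) = e ∧ 0 < n ∧ (∀ i, 0 < i → i < n → S.rot^[i] (S.glue f) ≠ e) ∧
      S.BoundaryPath r p C f e
        (S.crossLoop r p f * orbitWord S.rot (S.turnLoop r p) (S.glue f) n) := by
  classical
  have hex : ∃ n, S.rot^[n] (S.rot (S.glue f)) = e :=
    exists_iterate_of_sameCycle S.rot (Equiv.Perm.sameCycle_apply_left.2 hfe)
  set n := Nat.find hex with hn
  have hne : S.rot^[n] (S.rot (S.glue f)) = e := Nat.find_spec hex
  have hmin : ∀ i < n, S.rot^[i] (S.rot (S.glue f)) ≠ e := fun i hi => Nat.find_min hex hi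
  have hnot : ∀ i < n, ¬ (S.rot^[i] (S.rot (S.glue f)) ∈ C ∨
      S.glue (S.rot^[i] (S.rot (S.glue f))) ∈ C) := by
    intro i hi hc
    -- Before `e` is reached no side of the cut is met: such a side could only be `S.glue f`, after
    -- a full cycle, and then `e` would already have occurred during that cycle.
    rcases H _ (sameCycle_iterate S.rot _ (i + 1)) hc with h | h
    · exact hmin i hi h
    · have h1 : S.rot^[i + 1] (S.glue f) = S.glue f := h
      obtain ⟨m, hm⟩ := Nat.exists_eq_add_of_lt hi
      refine hmin m (by omega) ?_
      have h2 : S.rot^[n] (S.rot (S.glue f)) = S.rot^[m + 1] (S.rot^[i + 1] (S.glue f)) := by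
        rw [← Function.iterate_succ_apply S.rot n, ← Function.iterate_add_apply]
        congr 1
        omega
      rw [h1, hne] at h2
      exact h2.symm
  have h1 := boundaryPath_of_forall_not_mem (r := r) (p := p) n _ hnot
  have hrot : (S.cut C).rot f = S.rot (S.glue f) := by
    rw [cut_rot_of_mem hf, rot_apply, S.glue_glue]
  -- The count starts at `S.glue f`, one turn before `S.next f`. Thus `n + 1` is the first positive
  -- hitting time, and in the case e = `S.glue f` it is a full period.
  refine ⟨n + 1, hne, n.succ_pos, ?_, ?_⟩
  · rintro (_ | i) hi hin
    · exact absurd hi (lt_irrefl 0)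
    · exact hmin i (Nat.lt_of_succ_lt_succ hin)
  · rw [orbitWord_succ, ← mul_assoc, ← hne]
    refine BoundaryPath.trans ⟨1, hrot, ?_⟩ h1
    rw [orbitWord_succ, orbitWord_zero, mul_one, cutTurnLoop]
    refine (if_pos hf).trans ?_
    -- The step along `f` equals crossing `f` and then turning at `S.glue f`, which rewrites the
    -- first letter as part of a word of turns.
    rw [turnLoop_eq, ← mul_assoc, crossLoop_mul_crossLoop_glue, one_mul, S.glue_glue]

end PolygonSurface


/-! ### Flat sections adapted to the curves. -/

namespace ConeOrbifold

open groupCohomology PolygonSurface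

variable {O : ConeOrbifold} {p : O.Dart} {A : Rep.{0} ℝ (O.Gamma p)} (u : cocycles₁ A)

/-- A flat section for the affine action of the fundamental groupoid along all turns. -/
def IsFlat (X : O.Dart → A) : Prop :=
  ∀ d, X d = affineAct u (O.turnLoop O.order p d) (X (O.rot d))

variable {u} in
theorem IsFlat.orbitWord {X : O.Dart → A} (hX : IsFlat u X) (d : O.Dart) (k : ℕ) :
    X d = affineAct u (orbitWord O.rot (O.turnLoop O.order p) d k) (X (O.rot^[k] d)) := by
  refine flat_orbitWord O.rot _ u X d (fun j => ?_) k
  rw [Function.iterate_succ_apply']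
  exact hX _

/-- The holonomy around a vertex or a boundary component. -/
noncomputable def vertexLoop (O : ConeOrbifold) (p d : O.Dart) : O.Gamma p :=
  orbitWord O.rot (O.turnLoop O.order p) d (Function.minimalPeriod O.rot d)

/-- Around an interior vertex the holonomy has finite order, so averaging applies; around a boundary
component the fixed point is the hypothesis. -/
theorem exists_vertexLoop_fixed (hO : O.Connected)
    (hu : ∀ z, ∃ Y, affineAct u (O.boundaryLoop p z) Y = Y) (c : O.Vertex) :
    ∃ Y, affineAct u (O.vertexLoop p c.dart) Y = Y := by
  by_cases hc : O.Interior c.dart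
  · exact exists_affineAct_fixed_of_pow_eq_one u _ _ (O.order_pos _)
      (O.orbitWord_pow_eq_one O.order p _ hc)
  · obtain ⟨Y, hY⟩ := hu ⟨c, hO p _, hc⟩
    have h : O.boundaryLoop p ⟨c, hO p _, hc⟩ = O.vertexLoop p c.dart :=
      O.toLoop_link_eq_orbitWord O.order p c.dart
    exact ⟨Y, h ▸ hY⟩

namespace Curve

variable {ξ : O.Curve}

theorem side_mem_vertexDarts (j) : ξ.side j ∈ ξ.vertexDarts :=
  ⟨j, Or.inl (Equiv.Perm.SameCycle.refl _ _)⟩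

theorem glue_side_mem_vertexDarts (j) : O.glue (ξ.side j) ∈ ξ.vertexDarts :=
  ⟨j, Or.inr (Equiv.Perm.SameCycle.refl _ _)⟩

theorem rot_mem_vertexDarts {d : O.Dart} : O.rot d ∈ ξ.vertexDarts ↔ d ∈ ξ.vertexDarts := by
  simp only [vertexDarts, Set.mem_ofPred_eq, Equiv.Perm.sameCycle_apply_right]

theorem mem_darts_or_glue_mem_darts {d : O.Dart} (h : d ∈ ξ.darts ∨ O.glue d ∈ ξ.darts) :
    ∃ j, d = ξ.side j ∨ d = O.glue (ξ.side j) := by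
  rcases h with ⟨j, hj⟩ | ⟨j, hj⟩
  · exact ⟨j, Or.inl hj.symm⟩
  · exact ⟨j, Or.inr (by rw [hj, O.glue_glue])⟩

theorem toLoop_loop (ξ : O.Curve) (p : O.Dart) : O.toLoop O.order p (ξ.loop O.order) =
    orbitWord (O.toPolygonSurface.cut ξ.darts).rot (O.cutTurnLoop O.order p ξ.darts) (ξ.side 0)
      (Function.minimalPeriod (O.toPolygonSurface.cut ξ.darts).rot (ξ.side 0)) :=
  O.reglueLoop_link O.order p ξ.darts (ξ.side 0)

/-- A closed path along the boundary of the cut surface is a power of the loop of the curve. This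
allows the holonomy to be computed along any convenient closed boundary path. -/
theorem affineAct_fixed_of_boundaryPath {Y : A}
    (hY : affineAct u (O.toLoop O.order p (ξ.loop O.order)) Y = Y) {g : O.Gamma p}
    (h : O.BoundaryPath O.order p ξ.darts (ξ.side 0) (ξ.side 0) g) : affineAct u g Y = Y := by
  obtain ⟨k, hk, rfl⟩ := h
  obtain ⟨m, hm⟩ := exists_orbitWord_eq_pow _ (O.cutTurnLoop O.order p ξ.darts) _ k hk
  rw [toLoop_loop] at hY
  rw [hm]
  exact affineAct_pow_of_fixed u _ Y hY m

/-- A section that is flat around the vertices and across the sides of a simple closed curve. -/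
theorem IsSimpleClosed.exists_flat (hξ : ξ.IsSimpleClosed)
    (hfix : ∀ c : O.Vertex, ∃ Y, affineAct u (O.vertexLoop p c.dart) Y = Y) (Y : A)
    (hY : affineAct u (O.toLoop O.order p (ξ.loop O.order)) Y = Y) :
    ∃ X : O.Dart → A, IsFlat u X ∧
      ∀ d ∈ ξ.darts, X d = affineAct u (O.crossLoop O.order p d) (X (O.glue d)) := by
  set t := O.turnLoop O.order p
  set κ := O.crossLoop O.order p
  -- On its left side the cut boundary leads from one side of the curve to the next, around the
  -- vertex between them. The index `j + 1` is cyclic, so the last side leads back to `ξ.side 0`.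
  have hpath : ∀ j, ∃ n, O.rot^[n] (O.glue (ξ.side j)) = ξ.side (j + 1) ∧
      O.BoundaryPath O.order p ξ.darts (ξ.side j) (ξ.side (j + 1))
        (κ (ξ.side j) * orbitWord O.rot t (O.glue (ξ.side j)) n) := by
    intro j
    obtain ⟨n, h1, -, -, h2⟩ := exists_boundaryPath_of_mem (S := O.toPolygonSurface) (r := O.order)
      (p := p) (C := ξ.darts) (f := ξ.side j) (Or.inl ⟨j, rfl⟩) (hξ.step j) (by
        intro c hc hc'
        obtain ⟨i, rfl | rfl⟩ := mem_darts_or_glue_mem_darts hc'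
        · rw [hξ.injective _ _ (hc.symm.trans (hξ.step j))]
          exact Or.inl rfl
        · have h := hξ.injective _ _ ((hξ.step i).symm.trans (hc.symm.trans (hξ.step j)))
          rw [add_right_cancel h]
          exact Or.inr rfl)
    exact ⟨n, h1, h2⟩
  choose n hn hpath using hpath
  -- Transport of `Y` along the left boundary cycle; that `Y` is fixed by the loop makes it close
  -- up.
  obtain ⟨Z, hZ, hZflat⟩ := exists_flat_on_cycle (O.toPolygonSurface.cut ξ.darts).rot
    (O.cutTurnLoop O.order p ξ.darts) u (ξ.side 0) Y (by rw [← toLoop_loop]; exact hY)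
  have hmem : ∀ j, (O.toPolygonSurface.cut ξ.darts).rot.SameCycle (ξ.side 0) (ξ.side j) := by
    intro j
    induction j using Fin.induction with
    | zero => exact Equiv.Perm.SameCycle.refl _ _
    | succ j ih =>
      obtain ⟨k, hk, -⟩ := hpath j.castSucc
      rw [Fin.coeSucc_eq_succ] at hk
      rw [← hk]
      exact ih.trans (sameCycle_iterate _ _ k)
  have hstep : ∀ j, Z (ξ.side j) = affineAct u
      (κ (ξ.side j) * orbitWord O.rot t (O.glue (ξ.side j)) (n j)) (Z (ξ.side (j + 1))) := by
    intro j
    obtain ⟨k, hk, hk'⟩ := hpath j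
    rw [← hk', ← hk]
    refine flat_orbitWord _ _ u Z _ (fun i => ?_) k
    rw [Function.iterate_succ_apply']
    exact hZflat _ ((hmem j).trans (sameCycle_iterate _ _ i))
  -- The values of `Z` may be prescribed freely: the vertices of the curve are distinct and have
  -- trivial holonomy.
  obtain ⟨X, hX, hXflat⟩ := exists_flat_of_prescribed O.rot t u hfix ξ.side hξ.injective
    (fun j => Z (ξ.side j)) (fun j => by
      rw [O.orbitWord_eq_one O.order p _ (hξ.interior j) (hξ.order_one j) _
        Function.iterate_minimalPeriod, affineAct_one])
  refine ⟨X, hXflat, ?_⟩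
  rintro _ ⟨j, rfl⟩
  -- Turning at the end of side `j` carries the value at `O.glue (ξ.side j)` to that at the next
  -- side. Compared with the transport of `Z`, only the crossing remains.
  have h1 := IsFlat.orbitWord hXflat (O.glue (ξ.side j)) (n j)
  rw [h1, hn, hX, hX, hstep, affineAct_mul]

/-- A section that is flat around the vertices and across the sides of a full 1-suborbifold. -/
theorem IsFullOneSuborbifold.exists_flat (hξ : ξ.IsFullOneSuborbifold)
    (hfix : ∀ c : O.Vertex, ∃ Y, affineAct u (O.vertexLoop p c.dart) Y = Y) (Y : A)
    (hY : affineAct u (O.toLoop O.order p (ξ.loop O.order)) Y = Y) :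
    ∃ X : O.Dart → A, IsFlat u X ∧
      ∀ d ∈ ξ.darts, X d = affineAct u (O.crossLoop O.order p d) (X (O.glue d)) := by
  set t := O.turnLoop O.order p
  set κ := O.crossLoop O.order p
  have hκ : ∀ d, κ (O.glue d) = (κ d)⁻¹ := fun d =>
    (inv_eq_of_mul_eq_one_right (O.crossLoop_mul_crossLoop_glue O.order p d)).symm
  have hside : ∀ (j : Fin ξ.len) c, O.rot.SameCycle (ξ.side j.succ) c →
      (c ∈ ξ.darts ∨ O.glue c ∈ ξ.darts) →
        c = ξ.side j.succ ∨ c = O.glue (ξ.side j.castSucc) := by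
    intro j c hc hc'
    obtain ⟨i, rfl | rfl⟩ := mem_darts_or_glue_mem_darts hc'
    · rw [hξ.injective _ _ hc]
      exact Or.inl rfl
    · induction i using Fin.lastCases with
      | last => exact absurd hc (hξ.injective_last _)
      | cast i =>
        have h := hξ.injective _ _ (hc.trans (hξ.step i))
        rw [Fin.succ_injective _ h]
        exact Or.inr rfl
  have hzero : ∀ c, O.rot.SameCycle (ξ.side 0) c → (c ∈ ξ.darts ∨ O.glue c ∈ ξ.darts) →
      c = ξ.side 0 := by
    intro c hc hc'
    obtain ⟨i, rfl | rfl⟩ := mem_darts_or_glue_mem_darts hc'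
    · rw [hξ.injective _ _ hc]
    · induction i using Fin.lastCases with
      | last => exact absurd hc (hξ.injective_last _)
      | cast i => exact absurd (hξ.injective _ _ (hc.trans (hξ.step i))) (Fin.succ_ne_zero i).symm
  have hlast : ∀ c, O.rot.SameCycle (O.glue (ξ.side (Fin.last ξ.len))) c →
      (c ∈ ξ.darts ∨ O.glue c ∈ ξ.darts) → c = O.glue (ξ.side (Fin.last ξ.len)) := by
    intro c hc hc'
    obtain ⟨i, rfl | rfl⟩ := mem_darts_or_glue_mem_darts hc'
    · exact absurd hc.symm (hξ.injective_last _)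
    · induction i using Fin.lastCases with
      | last => rfl
      | cast i => exact absurd (hc.trans (hξ.step i)).symm (hξ.injective_last _)
  -- A first return is a full period, so at an end point of the arc the boundary picks up the
  -- generator of the isotropy group.
  have hperiod : ∀ (d : O.Dart) n, O.rot^[n] d = d → 0 < n →
      (∀ i, 0 < i → i < n → O.rot^[i] d ≠ d) → orbitWord O.rot t d n = O.vertexLoop p d := by
    intro d n h1 h2 h3
    have h4 : Function.minimalPeriod O.rot d ≤ n :=
      Function.IsPeriodicPt.minimalPeriod_le h2 h1
    have h5 : 0 < Function.minimalPeriod O.rot d :=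
      Function.IsPeriodicPt.minimalPeriod_pos h2 h1
    rcases h4.lt_or_eq with h | h
    · exact absurd Function.iterate_minimalPeriod (h3 _ h5 h)
    · rw [← h]
      rfl
  -- along the arc, on its left side
  have hforth : ∀ j : Fin ξ.len, ∃ n, O.rot^[n] (O.glue (ξ.side j.castSucc)) = ξ.side j.succ ∧
      O.BoundaryPath O.order p ξ.darts (ξ.side j.castSucc) (ξ.side j.succ)
        (κ (ξ.side j.castSucc) * orbitWord O.rot t (O.glue (ξ.side j.castSucc)) n) := by
    intro j
    obtain ⟨n, h1, -, -, h2⟩ := exists_boundaryPath_of_mem (S := O.toPolygonSurface) (r := O.order)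
      (p := p) (C := ξ.darts) (f := ξ.side j.castSucc) (Or.inl ⟨_, rfl⟩) (hξ.step j)
      (fun c hc hc' => hside j c ((hξ.step j).symm.trans hc) hc')
    exact ⟨n, h1, h2⟩
  choose n hn hforth using hforth
  -- back along the arc, on its right side
  have hback : ∀ j : Fin ξ.len, O.BoundaryPath O.order p ξ.darts (O.glue (ξ.side j.succ))
      (O.glue (ξ.side j.castSucc))
      ((κ (ξ.side j.succ))⁻¹ * (orbitWord O.rot t (O.glue (ξ.side j.castSucc)) (n j))⁻¹) := by
    intro j
    obtain ⟨m, h1, -, -, h2⟩ := exists_boundaryPath_of_mem (S := O.toPolygonSurface) (r := O.order)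
      (p := p) (C := ξ.darts) (f := O.glue (ξ.side j.succ)) (e := O.glue (ξ.side j.castSucc))
      (Or.inr ⟨j.succ, (O.glue_glue _).symm⟩)
      (by rw [O.glue_glue]; exact (hξ.step j).symm)
      (by
        rw [O.glue_glue]
        exact fun c hc hc' => (hside j c hc hc').symm)
    rw [O.glue_glue] at h1 h2
    -- The turns on the two sides of the arc together go once or more around a regular vertex and
    -- have trivial product, so the way back inverts the way forth.
    have h3 : orbitWord O.rot t (ξ.side j.succ) (m + n j) = 1 :=
      O.orbitWord_eq_one O.order p _ (hξ.interior _) (hξ.order_one j) _ (by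
        rw [add_comm, Function.iterate_add_apply, h1, hn])
    rw [orbitWord_add, h1] at h3
    rw [← eq_inv_of_mul_eq_one_left h3, ← hκ]
    exact h2
  have hturn_last : O.BoundaryPath O.order p ξ.darts (ξ.side (Fin.last _))
      (O.glue (ξ.side (Fin.last _)))
      (κ (ξ.side (Fin.last _)) * O.vertexLoop p (O.glue (ξ.side (Fin.last _)))) := by
    obtain ⟨m, h1, h2, h3, h4⟩ := exists_boundaryPath_of_mem (S := O.toPolygonSurface)
      (r := O.order) (p := p) (C := ξ.darts) (f := ξ.side (Fin.last _)) (Or.inl ⟨_, rfl⟩)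
      (Equiv.Perm.SameCycle.refl _ _) (fun c hc hc' => Or.inl (hlast c hc hc'))
    rw [hperiod _ m h1 h2 h3] at h4
    exact h4
  have hturn_zero : O.BoundaryPath O.order p ξ.darts (O.glue (ξ.side 0)) (ξ.side 0)
      ((κ (ξ.side 0))⁻¹ * O.vertexLoop p (ξ.side 0)) := by
    obtain ⟨m, h1, h2, h3, h4⟩ := exists_boundaryPath_of_mem (S := O.toPolygonSurface)
      (r := O.order) (p := p) (C := ξ.darts) (f := O.glue (ξ.side 0)) (e := ξ.side 0)
      (Or.inr ⟨0, (O.glue_glue _).symm⟩)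
      (by rw [O.glue_glue])
      (by
        rw [O.glue_glue]
        exact fun c hc hc' => Or.inl (hzero c hc hc'))
    rw [O.glue_glue] at h1 h3 h4
    rw [hperiod _ m h1 h2 h3] at h4
    rw [← hκ]
    exact h4
  -- `Q j` is the holonomy along the left of the arc from `ξ.side 0` up to and across `ξ.side j`.
  obtain ⟨Q, hQ0, hQs⟩ : ∃ Q : Fin (ξ.len + 1) → O.Gamma p, Q 0 = κ (ξ.side 0) ∧
      ∀ j : Fin ξ.len, Q j.succ = Q j.castSucc *
        orbitWord O.rot t (O.glue (ξ.side j.castSucc)) (n j) * κ (ξ.side j.succ) :=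
    ⟨Fin.induction (κ (ξ.side 0)) fun j q =>
      q * orbitWord O.rot t (O.glue (ξ.side j.castSucc)) (n j) * κ (ξ.side j.succ),
      Fin.induction_zero _ _, fun j => Fin.induction_succ _ _ j⟩
  have hQ : ∀ j, O.BoundaryPath O.order p ξ.darts (ξ.side 0) (ξ.side j)
        (Q j * (κ (ξ.side j))⁻¹) ∧
      O.BoundaryPath O.order p ξ.darts (O.glue (ξ.side j)) (ξ.side 0)
        ((Q j)⁻¹ * O.vertexLoop p (ξ.side 0)) := by
    intro j
    induction j using Fin.induction with
    | zero =>
      rw [hQ0, mul_inv_cancel]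
      exact ⟨BoundaryPath.refl _, hturn_zero⟩
    | succ j ih =>
      refine ⟨?_, ?_⟩
      · have h := ih.1.trans (hforth j)
        rw [mul_assoc, inv_mul_cancel_left] at h
        rw [hQs, mul_inv_cancel_right]
        exact h
      · have h := (hback j).trans ih.2
        rw [hQs, mul_inv_rev, mul_inv_rev]
        simpa only [mul_assoc] using h
  obtain ⟨g, hg⟩ : ∃ g, g = Q (Fin.last _) := ⟨_, rfl⟩
  set s₁ := g * O.vertexLoop p (O.glue (ξ.side (Fin.last _))) * g⁻¹ with hs₁
  set s₂ := O.vertexLoop p (ξ.side 0)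
  -- Forth along the arc, around the far cone point, back along the other side and around the first
  -- cone point: the holonomies along the arc conjugate the far generator, which gives s₁s₂.
  have hloop : O.BoundaryPath O.order p ξ.darts (ξ.side 0) (ξ.side 0) (s₁ * s₂) := by
    have h := ((hQ (Fin.last _)).1.trans hturn_last).trans (hQ (Fin.last _)).2
    rw [← hg] at h
    convert h using 1
    rw [hs₁]
    group
  have hinv₁ : s₁ * s₁ = 1 := by
    have h := O.orbitWord_pow_eq_one O.order p _ hξ.interior_last
    rw [hξ.order_last, pow_two] at h
    have h' : O.vertexLoop p (O.glue (ξ.side (Fin.last _))) *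
      O.vertexLoop p (O.glue (ξ.side (Fin.last _))) = 1 := h
    rw [hs₁]
    calc _ = g * (O.vertexLoop p (O.glue (ξ.side (Fin.last _))) *
          O.vertexLoop p (O.glue (ξ.side (Fin.last _)))) * g⁻¹ := by group
      _ = 1 := by rw [h', mul_one, mul_inv_cancel]
  have hinv₂ : s₂ * s₂ = 1 := by
    have h := O.orbitWord_pow_eq_one O.order p _ (hξ.interior 0)
    rw [hξ.order_first, pow_two] at h
    exact h
  obtain ⟨Z, hZ₁, hZ₂⟩ := exists_affineAct_fixed_of_involutions u s₁ s₂ hinv₁ hinv₂ Y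
    (affineAct_fixed_of_boundaryPath u hY hloop)
  -- The common fixed point `Z` is transported along the arc, one value per vertex; `none` stands
  -- for the far end point. At the two ends, s₁Z = Z and s₂Z = Z are the conditions of
  -- `exists_flat_of_prescribed`; at inner vertices the holonomy is trivial.
  obtain ⟨X, hX, hXflat⟩ := exists_flat_of_prescribed O.rot t u hfix
    (fun j : Option (Fin (ξ.len + 1)) =>
      j.elim (O.glue (ξ.side (Fin.last _))) ξ.side)
    (by
      rintro (_ | i) (_ | j) h
      · rfl
      · exact absurd h.symm (hξ.injective_last j)
      · exact absurd h (hξ.injective_last i)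
      · exact congrArg some (hξ.injective i j h))
    (fun j => j.elim (affineAct u g⁻¹ Z) fun j => affineAct u (κ (ξ.side j) * (Q j)⁻¹) Z)
    (by
      rintro (_ | j)
      · change affineAct u (O.vertexLoop p (O.glue (ξ.side (Fin.last _)))) (affineAct u g⁻¹ Z) =
          affineAct u g⁻¹ Z
        conv_rhs => rw [← hZ₁]
        rw [← affineAct_mul, ← affineAct_mul, hs₁]
        congr 1
        group
      · change affineAct u (O.vertexLoop p (ξ.side j)) (affineAct u (κ (ξ.side j) * (Q j)⁻¹) Z) =
          affineAct u (κ (ξ.side j) * (Q j)⁻¹) Z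
        induction j using Fin.cases with
        | zero => rw [hQ0, mul_inv_cancel, affineAct_one, hZ₂]
        | succ j =>
          have h : O.vertexLoop p (ξ.side j.succ) = 1 :=
            O.orbitWord_eq_one O.order p _ (hξ.interior _) (hξ.order_one j) _
              Function.iterate_minimalPeriod
          rw [h, affineAct_one])
  have hXl : X (O.glue (ξ.side (Fin.last _))) = affineAct u g⁻¹ Z := hX none
  have hXs : ∀ j, X (ξ.side j) = affineAct u (κ (ξ.side j) * (Q j)⁻¹) Z := fun j => hX (some j)
  refine ⟨X, hXflat, ?_⟩
  rintro _ ⟨j, rfl⟩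
  rw [hXs]
  induction j using Fin.lastCases with
  | last => rw [hXl, affineAct_mul, hg]
  | cast j =>
    have h1 := IsFlat.orbitWord hXflat (O.glue (ξ.side j.castSucc)) (n j)
    rw [hn, hXs] at h1
    change _ = affineAct u (orbitWord O.rot t _ _) _ at h1
    rw [h1, ← affineAct_mul, ← affineAct_mul, hQs]
    congr 1
    group

end Curve

/-- A cocycle that is parabolic relative to the boundary and the curves of a cut system has a
primitive that is flat around all vertices and across all sides of the curves. -/
theorem CutSystem.exists_flat (hO : O.Connected) {m : ℕ} (ξ : O.CutSystem m)
    (hu : ∀ z, ∃ Y, affineAct u (O.boundaryLoop p z) Y = Y)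
    (hξ : ∀ i, ∃ Y, affineAct u (O.toLoop O.order p ((ξ.curve i).loop O.order)) Y = Y) :
    ∃ X : O.Dart → A, IsFlat u X ∧
      ∀ d ∈ ξ.darts, X d = affineAct u (O.crossLoop O.order p d) (X (O.glue d)) := by
  classical
  have hfix := exists_vertexLoop_fixed u hO hu
  have h1 : ∀ i, ∃ X : O.Dart → A, IsFlat u X ∧
      ∀ d ∈ (ξ.curve i).darts, X d = affineAct u (O.crossLoop O.order p d) (X (O.glue d)) := by
    intro i
    obtain ⟨Y, hY⟩ := hξ i
    rcases ξ.curve_type i with h | h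
    · exact h.1.exists_flat u hfix Y hY
    · exact h.exists_flat u hfix Y hY
  choose X hX hX' using h1
  -- A flat section without prescribed values, used at the vertices on no curve.
  obtain ⟨X₀, -, hX₀⟩ := exists_flat_of_prescribed O.rot (O.turnLoop O.order p) u hfix
    (fun i : Empty => i.elim) (fun i => i.elim) (fun i => i.elim) (fun i => i.elim)
  -- Patching is consistent because `vertexDarts` is invariant under `O.rot`, contains both sides of
  -- every edge of its curve, and is disjoint for different curves.
  set Z : O.Dart → A := fun d =>
    if h : ∃ i, d ∈ (ξ.curve i).vertexDarts then X h.choose d else X₀ d with hZdef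
  have hZ : ∀ i d, d ∈ (ξ.curve i).vertexDarts → Z d = X i d := by
    intro i d hd
    have h : ∃ i, d ∈ (ξ.curve i).vertexDarts := ⟨i, hd⟩
    have h2 : h.choose = i := by
      by_contra hne
      exact Set.disjoint_left.1 (ξ.disjoint _ _ hne) h.choose_spec hd
    have h3 : Z d = X h.choose d := dif_pos h
    rw [h3, h2]
  refine ⟨Z, fun d => ?_, fun d hd => ?_⟩
  · by_cases h : ∃ i, d ∈ (ξ.curve i).vertexDarts
    · obtain ⟨i, hi⟩ := h
      rw [hZ i d hi, hZ i _ (Curve.rot_mem_vertexDarts.2 hi)]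
      exact hX i d
    · have h' : ¬ ∃ i, O.rot d ∈ (ξ.curve i).vertexDarts := by
        simpa only [Curve.rot_mem_vertexDarts] using h
      have h2 : Z d = X₀ d := dif_neg h
      have h3 : Z (O.rot d) = X₀ (O.rot d) := dif_neg h'
      rw [h2, h3]
      exact hX₀ d
  · obtain ⟨i, j, rfl⟩ := Set.mem_iUnion.1 hd
    rw [hZ i _ (Curve.side_mem_vertexDarts j), hZ i _ (Curve.glue_side_mem_vertexDarts j)]
    exact hX' i _ ⟨j, rfl⟩

end ConeOrbifold


/-! ### Comparison of the joining paths in a piece and in the whole surface. -/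

namespace PolygonSurface

variable (S : PolygonSurface) (r : S.Dart → ℕ) (p : S.Dart)

theorem toLoop_inv {a b : S.Dart} (f : S.pt r a ⟶ S.pt r b) :
    S.toLoop r p (inv f) = (S.toLoop r p f)⁻¹ := by
  refine eq_inv_of_mul_eq_one_left ?_
  rw [← toLoop_comp, IsIso.inv_hom_id]
  exact S.toLoop_eqToHom r p rfl

/-- The path chosen to join `p` to itself need not be constant, so on genuine loops `toLoop` is only
a conjugation. -/
theorem exists_toLoop_eq_conj : ∃ e : S.Pi1 r p, ∀ x : S.Pi1 r p, S.toLoop r p x = e * x * e⁻¹ := by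
  have h : S.Conn r p p := ⟨𝟙 _⟩
  refine ⟨h.some, fun x => ?_⟩
  have h1 : S.toLoop r p x = h.some ≫ x ≫ inv h.some := dif_pos h
  rw [h1, ← Category.assoc]
  change _ = (h.some ≫ x) ≫ Groupoid.inv h.some
  rw [Groupoid.inv_eq_inv]

theorem reglueLoop_inv (C : Set S.Dart) {a b : S.Dart}
    (f : (S.cut C).pt r a ⟶ (S.cut C).pt r b) :
    S.reglueLoop r p C (inv f) = (S.reglueLoop r p C f)⁻¹ := by
  refine eq_inv_of_mul_eq_one_left ?_
  rw [← reglueLoop_comp, IsIso.inv_hom_id]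
  exact S.reglueLoop_eqToHom r p C rfl

/-- The inclusion of a piece of the cut surface intertwines the two ways to close up paths up to a
change of the joining paths. -/
theorem exists_inclusion_toLoop (C : Set S.Dart) {q : S.Dart} (h : S.pt r p ⟶ S.pt r q) :
    ∃ g : S.Dart → S.Pi1 r p, ∀ (a b : S.Dart) (f : (S.cut C).pt r a ⟶ (S.cut C).pt r b),
      (S.cut C).Conn r q a →
        S.inclusion r C h ((S.cut C).toLoop r q f) = g a * S.reglueLoop r p C f * (g b)⁻¹ := by
  classical
  obtain ⟨e, he⟩ := S.exists_toLoop_eq_conj r p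
  -- `g d` runs from `p` to `q` along `h`, then inside the piece to `d`, and is closed up in the
  -- original surface; `e⁻¹` undoes the conjugation by the chosen path at `p`. Outside the piece the
  -- value 1 is never used.
  obtain ⟨g, hg⟩ : ∃ g : S.Dart → S.Pi1 r p, ∀ (d : S.Dart) (hd : (S.cut C).Conn r q d),
      g d = e⁻¹ * S.toLoop r p h * S.reglueLoop r p C hd.some :=
    ⟨fun d => if hd : (S.cut C).Conn r q d then
      e⁻¹ * S.toLoop r p h * S.reglueLoop r p C hd.some else 1, fun d hd => dif_pos hd⟩
  refine ⟨g, fun a b f ha => ?_⟩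
  have hb : (S.cut C).Conn r q b := Nonempty.map (fun g => g ≫ f) ha
  have h1 : (S.cut C).toLoop r q f = ha.some ≫ f ≫ inv hb.some := dif_pos ha
  have h2 : S.toLoop r p (S.inclusion r C h ((S.cut C).toLoop r q f)) =
      S.toLoop r p h * (S.reglueLoop r p C ((S.cut C).toLoop r q f) * (S.toLoop r p h)⁻¹) := by
    rw [← toLoop_inv]
    exact (S.toLoop_comp r p _ _).trans (congrArg _ (S.toLoop_comp r p _ _))
  rw [he, h1, reglueLoop_comp, reglueLoop_comp, reglueLoop_inv] at h2
  rw [hg a ha, hg b hb, h1]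
  have h3 : ∀ x y : S.Pi1 r p, e * x * e⁻¹ = y → x = e⁻¹ * y * e := by
    rintro x _ rfl
    group
  rw [h3 _ _ h2]
  group

end PolygonSurface

/-! ### Flat sections as relative cocycles, and restriction of classes to pieces. -/

section Stabilizer

open groupCohomology

variable {G : Type} [Group G] {A : Rep.{0} ℝ G} (u : cocycles₁ A)

/-- The stabilizer of a point for the affine action. -/
def affineStabilizer (Y : A) : Subgroup G where
  carrier := {g | affineAct u g Y = Y}
  one_mem' := affineAct_one u Y
  mul_mem' {g h} hg hh := by
    change affineAct u (g * h) Y = Y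
    rw [affineAct_mul, show affineAct u h Y = Y from hh]
    exact hg
  inv_mem' {g} hg := by
    change affineAct u g⁻¹ Y = Y
    have h : affineAct u g Y = Y := hg
    conv_lhs => rw [← h]
    rw [← affineAct_mul, inv_mul_cancel, affineAct_one]

/-- Stabilizers are subgroups, so a fixed point of the generator is fixed by the whole cyclic group;
fixing `Y` is the same as `u` being the coboundary of `Y`. -/
theorem eq_sub_of_mem_zpowers {z : G} {Y : A} (hz : affineAct u z Y = Y) (h : G)
    (hh : h ∈ Subgroup.zpowers z) : u h = A.ρ h Y - Y := by
  have h1 : h ∈ affineStabilizer u Y := Subgroup.zpowers_le.2 hz hh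
  have h2 : A.ρ h Y - u h = Y := h1
  rw [sub_eq_iff_eq_add.1 h2, add_sub_cancel_left]

end Stabilizer

namespace ConeOrbifold

open groupCohomology PolygonSurface

section Flat

variable {O : ConeOrbifold} {p : O.Dart} {A : Rep.{0} ℝ (O.Gamma p)} (u : cocycles₁ A)

/-- A flat section makes a cocycle a relative cocycle. -/
theorem exists_relCocycle_of_flat (X : O.Dart → A)
    (hX : ∀ d, O.Conn O.order p d → X d = affineAct u (O.turnLoop O.order p d) (X (O.rot d))) :
    ∃ x : relCocycles₁ A (O.boundarySubgroup p), relCocycles₁.toCocycle A _ x = u ∧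
      ∀ z, x.1.2 z = X z.1.dart := by
  refine ⟨⟨(u.1, fun z => X z.1.dart), u.2, fun z h hh => ?_⟩, rfl, fun _ => rfl⟩
  refine eq_sub_of_mem_zpowers u ?_ h hh
  have hconn : ∀ j, O.Conn O.order p (O.rot^[j] z.1.dart) := by
    intro j
    induction j with
    | zero => exact z.2.1
    | succ j ih =>
      rw [Function.iterate_succ_apply']
      exact (O.conn_rot O.order p _).1 ih
  have h1 := flat_orbitWord O.rot (O.turnLoop O.order p) u X z.1.dart (fun j => by
    rw [Function.iterate_succ_apply']
    exact hX _ (hconn j)) (O.valence z.1.dart)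
  rw [O.iterate_valence] at h1
  have h2 : O.boundaryLoop p z = orbitWord O.rot (O.turnLoop O.order p) z.1.dart
      (O.valence z.1.dart) := O.toLoop_link_eq_orbitWord O.order p z.1.dart
  rw [h2]
  exact h1.symm

/-- A section that is flat around the vertices and across the sides in `C` is flat along the turns
of the surface cut open along `C`. -/
theorem IsFlat.cut {u : cocycles₁ A} {X : O.Dart → A} (hX : IsFlat u X) {C : Set O.Dart}
    (hC : ∀ d ∈ C, X d = affineAct u (O.crossLoop O.order p d) (X (O.glue d))) (d : O.Dart) :
    X d = affineAct u (O.cutTurnLoop O.order p C d) (X ((O.toPolygonSurface.cut C).rot d)) := by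
  by_cases h : d ∈ C ∨ O.glue d ∈ C
  · have h1 : X d = affineAct u (O.crossLoop O.order p d) (X (O.glue d)) := by
      rcases h with h | h
      · exact hC d h
      · have h2 := hC _ h
        rw [O.glue_glue] at h2
        rw [h2, ← affineAct_mul, crossLoop_mul_crossLoop_glue, affineAct_one]
    -- At a cut side the turn is the crossing of `d` followed by the turn at `O.glue d`; the section
    -- is parallel along both.
    rw [cutTurnLoop, if_pos h, cut_rot_of_mem h, h1, hX (O.glue d), ← affineAct_mul, turnLoop_eq,
      ← mul_assoc, crossLoop_mul_crossLoop_glue, one_mul, rot_apply, O.glue_glue]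
  · rw [cutTurnLoop, if_neg h, cut_rot_of_not_mem h]
    exact hX d

end Flat

section Pieces

variable {n : ℕ}

/-- The pullback of a cocycle to a piece of the cut orbifold. -/
noncomputable def pullbackCocycle {G H : Type} [Group G] [Group H] (ι : H →* G) (ρ : G →* PSL n)
    (u : cocycles₁ (adRep ρ)) : cocycles₁ (adRep (ρ.comp ι)) :=
  mapCocycles₁ ι (𝟙 (adRep (ρ.comp ι)) : Rep.res ι (adRep ρ) ⟶ adRep (ρ.comp ι)) u

/-- Kept general in the coefficient map; the case needed is the identity, as restricting `adRep ρ`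
along `ι` gives `adRep (ρ.comp ι)` by definition. -/
theorem map_one_hom_H1π {G H : Type} [Group G] [Group H] (ι : H →* G) (A : Rep.{0} ℝ G)
    (B : Rep.{0} ℝ H) (φ : Rep.res ι A ⟶ B) (u : cocycles₁ A) :
    (groupCohomology.map ι φ 1).hom (H1π A u) = H1π B (mapCocycles₁ ι φ u) :=
  H1π_comp_map_apply ι φ u

theorem pullbackH1_H1π {G H : Type} [Group G] [Group H] (ι : H →* G) (ρ : G →* PSL n)
    (u : cocycles₁ (adRep ρ)) :
    pullbackH1 ι ρ (H1π (adRep ρ) u) = H1π (adRep (ρ.comp ι)) (pullbackCocycle ι ρ u) :=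
  map_one_hom_H1π ι (adRep ρ) (adRep (ρ.comp ι)) (𝟙 (adRep (ρ.comp ι))) u

end Pieces

end ConeOrbifold


/-! ### Invariance of the contributions of polygons and sides. -/

/-- Summing over the parts of a partition is summing over everything. -/
theorem sum_sum_filter_of_existsUnique {I D : Type} [Fintype I] [Fintype D] (P : I → D → Prop)
    [∀ i, DecidablePred (P i)] (hP : ∀ d, ∃! i, P i d) (F : D → ℝ) :
    ∑ i, ∑ d with P i d, F d = ∑ d, F d := by
  simp only [Finset.sum_filter]
  rw [Finset.sum_comm]
  refine Finset.sum_congr rfl fun d _ => ?_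
  obtain ⟨i, hi, hi'⟩ := hP d
  rw [Finset.sum_eq_single i (fun j _ hj => if_neg fun h => hj (hi' j h))
    (fun h => absurd (Finset.mem_univ i) h), if_pos hi]

namespace ConeOrbifold

open groupCohomology PolygonSurface

variable {n : ℕ}

section Gauge

variable {D G H : Type} [Group G] [Group H] (ι : H →* G) (ρ : G →* PSL n)
  (u v : cocycles₁ (adRep ρ)) (X Y : D → slAlg n) (g : D → G)

/-- The section `X` after changing the path that leads to the point `d` by `g d`. -/
noncomputable def transport (u : cocycles₁ (adRep ρ)) (g : D → G) (X : D → slAlg n) (d : D) :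
    slAlg n :=
  affineAct u (g d) (X d)

/-- The inner factor (g b)⁻¹ cancels against the transport of `X b`, and the common factor `g a`
acts on a difference of points through its linear part. -/
theorem twist_pullbackCocycle {a b : D} {γ : G} {η : H} (h : ι η = g a * γ * (g b)⁻¹) :
    (twist (pullbackCocycle ι ρ u) (transport ρ u g X) a η b : slAlg n) =
      adPSL n (ρ (g a)) (twist u X a γ b : slAlg n) := by
  have h1 : (twist (pullbackCocycle ι ρ u) (transport ρ u g X) a η b : slAlg n) =
      affineAct u (g a) (X a) - affineAct u (ι η) (affineAct u (g b) (X b)) := rfl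
  have h2 : (affineAct u (g a) (X a) - affineAct u (g a) (affineAct u γ (X b)) : slAlg n) =
      adPSL n (ρ (g a)) (twist u X a γ b : slAlg n) := affineAct_sub u (g a) _ _
  rw [h1, ← h2, h, ← affineAct_mul, inv_mul_cancel_right, affineAct_mul]

/-- Both factors are moved by the adjoint action of the same element `g a`, so the invariance of the
trace form applies. -/
theorem twistCup_pullbackCocycle {a b c : D} {γ δ : G} {η θ : H}
    (h : ι η = g a * γ * (g b)⁻¹) (h' : ι θ = g b * δ * (g c)⁻¹) :
    twistCup (A := adRep (ρ.comp ι)) (traceForm n) (pullbackCocycle ι ρ u)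
        (pullbackCocycle ι ρ v) (transport ρ u g X)
        (transport ρ v g Y) a η b θ c =
      twistCup (A := adRep ρ) (traceForm n) u v X Y a γ b δ c := by
  have e1 := twist_pullbackCocycle ι ρ u X g h
  have e2 := twist_pullbackCocycle ι ρ v Y g h'
  have e3 : adPSL n (ρ (ι η)) (adPSL n (ρ (g b)) (twist v Y b δ c : slAlg n)) =
      adPSL n (ρ (g a)) (adPSL n (ρ γ) (twist v Y b δ c : slAlg n)) := by
    rw [← Module.End.mul_apply, ← Module.End.mul_apply, ← map_mul, ← map_mul, ← map_mul, ← map_mul,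
      h, inv_mul_cancel_right]
  change traceForm n (twist (pullbackCocycle ι ρ u) (transport ρ u g X) a η b)
    (adPSL n (ρ (ι η)) (twist (pullbackCocycle ι ρ v)
      (transport ρ v g Y) b θ c)) =
    traceForm n (twist u X a γ b) (adPSL n (ρ γ) (twist v Y b δ c))
  rw [e1, e2, e3, traceForm_ad]

end Gauge

variable {O : ConeOrbifold} {p : O.Dart} (ρ : O.Gamma p →* PSL n)

/-- The contribution of a polygon to the pairing. -/
noncomputable def facePairing (u v : cocycles₁ (adRep ρ)) (X Y : O.Dart → slAlg n)
    (f : O.Face) : ℝ :=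
  ∑ j ∈ Finset.range (O.faceSize f), twistCup (A := adRep ρ) (traceForm n) u v X Y f.dart
    ((List.range j).map (O.faceLetters O.order p f.dart)).prod (O.next^[j] f.dart)
    (O.sideLoop O.order p (O.next^[j] f.dart)) (O.next^[j + 1] f.dart)

/-- The contribution of a side to the pairing. -/
noncomputable def sidePairing (u v : cocycles₁ (adRep ρ)) (X Y : O.Dart → slAlg n)
    (d : O.Dart) : ℝ :=
  traceForm n (twist u X d (O.sideLoop O.order p d) (O.next d))
    (twist v Y d (O.sideLoop O.order p d) (O.next d))

open Classical in
-- Locality of the form: crossings, and with them the gluing, occur only in the flatness hypotheses.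
theorem omegaABG_eq_sum_faces (u v : cocycles₁ (adRep ρ)) (X Y : O.Dart → slAlg n)
    (hX : ∀ d, O.Conn O.order p d → X d = affineAct u (O.turnLoop O.order p d) (X (O.rot d)))
    (hY : ∀ d, O.Conn O.order p d → Y d = affineAct v (O.turnLoop O.order p d) (Y (O.rot d)))
    (a b : parH1 (adRep ρ) (O.boundarySubgroup p)) (ha : H1π (adRep ρ) u = a.1)
    (hb : H1π (adRep ρ) v = b.1) :
    omegaABG ρ a b =
      (∑ f : O.Face with O.Conn O.order p f.dart, facePairing ρ u v X Y f)
      + (1 / 2) * ∑ d : O.Dart with O.Conn O.order p d, sidePairing ρ u v X Y d := by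
  obtain ⟨x, rfl, hx⟩ := exists_relCocycle_of_flat u X hX
  obtain ⟨y, rfl, -⟩ := exists_relCocycle_of_flat v Y hY
  rw [omegaABG_eq ρ a b x y ha hb]
  exact pairing_eq_sum_faces (A := adRep ρ) (traceForm n) (fun g X Y => traceForm_ad (ρ g) X Y)
    x _ X Y hX hY hx

section Pieces

variable {C : Set O.Dart} {q : O.Dart} (h : O.pt O.order p ⟶ O.pt O.order q)

/-- A section that is flat along the turns of the cut surface becomes flat on a piece after the
change of the joining paths. -/
theorem isFlat_pullbackCocycle (u : cocycles₁ (adRep ρ)) (X : O.Dart → slAlg n)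
    (hX : ∀ d, X d = affineAct u (O.cutTurnLoop O.order p C d)
      (X ((O.toPolygonSurface.cut C).rot d)))
    (g : O.Dart → O.Gamma p)
    (hg : ∀ (a b : O.Dart) (f : (O.toPolygonSurface.cut C).pt O.order a ⟶
      (O.toPolygonSurface.cut C).pt O.order b), (O.toPolygonSurface.cut C).Conn O.order q a →
        O.inclusion C h ((O.toPolygonSurface.cut C).toLoop O.order q f) =
          g a * O.reglueLoop O.order p C f * (g b)⁻¹)
    (d : (O.cut C).Dart) (hd : (O.cut C).Conn (O.cut C).order q d) :
    transport ρ u g X d = affineAct (pullbackCocycle (O.inclusion C h) ρ u)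
      ((O.cut C).turnLoop (O.cut C).order q d) (transport ρ u g X ((O.cut C).rot d)) := by
  have h1 := hg d ((O.cut C).rot d) ((O.cut C).turn (O.cut C).order d) hd
  have h2 := twist_pullbackCocycle (O.inclusion C h) ρ u X g h1
  have h3 : twist u X d (O.reglueLoop O.order p C ((O.cut C).turn (O.cut C).order d))
      ((O.cut C).rot d) = 0 := by
    have h4 : O.reglueLoop O.order p C ((O.cut C).turn (O.cut C).order d) =
      O.cutTurnLoop O.order p C d := O.reglueLoop_turn O.order p C d
    rw [h4]
    exact sub_eq_zero.2 (hX d)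
  rw [h3] at h2
  exact sub_eq_zero.1 (h2.trans (map_zero _))

/-- Cutting does not change the polygons, and the paths inside a polygon are the same up to the
change `g` of joining paths. -/
theorem facePairing_pullbackCocycle (u v : cocycles₁ (adRep ρ)) (X Y : O.Dart → slAlg n)
    (g : O.Dart → O.Gamma p)
    (hg : ∀ (a b : O.Dart) (f : (O.toPolygonSurface.cut C).pt O.order a ⟶
      (O.toPolygonSurface.cut C).pt O.order b), (O.toPolygonSurface.cut C).Conn O.order q a →
        O.inclusion C h ((O.toPolygonSurface.cut C).toLoop O.order q f) =
          g a * O.reglueLoop O.order p C f * (g b)⁻¹)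
    (f : (O.cut C).Face) (hf : (O.cut C).Conn (O.cut C).order q f.dart) :
    facePairing (O := O.cut C) (p := q) (ρ.comp (O.inclusion C h))
      (pullbackCocycle (O.inclusion C h) ρ u) (pullbackCocycle (O.inclusion C h) ρ v)
      (transport ρ u g X) (transport ρ v g Y) f =
    facePairing (O := O) ρ u v X Y f := by
  refine Finset.sum_congr rfl fun j _ => ?_
  have hconn : ∀ j, (O.cut C).Conn (O.cut C).order q ((O.cut C).next^[j] f.dart) := by
    intro j
    induction j with
    | zero => exact hf
    | succ j ih =>
      rw [Function.iterate_succ_apply']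
      exact ((O.cut C).conn_next (O.cut C).order q _).1 ih
  refine twistCup_pullbackCocycle (O.inclusion C h) ρ u v X Y g ?_ ?_
  · have h1 := hg _ _ (((O.cut C).proj (O.cut C).order).map
      (FreeGpd.sides (O.cut C).toPolygonSurface j f.dart)) hf
    have h2 : O.reglueLoop O.order p C (((O.cut C).proj (O.cut C).order).map
        (FreeGpd.sides (O.cut C).toPolygonSurface j f.dart)) =
        ((List.range j).map (O.faceLetters O.order p f.dart)).prod :=
      (congrArg (O.toLoop O.order p) (O.reglueFree_sides O.order C j f.dart)).trans
        (O.toLoop_sides O.order p f.dart j)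
    rw [h2] at h1
    refine Eq.trans ?_ h1
    exact congrArg (O.inclusion C h) ((O.cut C).toLoop_sides (O.cut C).order q f.dart j).symm
  · rw [Function.iterate_succ_apply']
    have h1 := hg _ _ ((O.cut C).side (O.cut C).order ((O.cut C).next^[j] f.dart)) (hconn j)
    exact h1.trans (congrArg (fun z => g _ * z * (g _)⁻¹) (O.reglueLoop_side O.order p C _))

theorem sidePairing_pullbackCocycle (u v : cocycles₁ (adRep ρ)) (X Y : O.Dart → slAlg n)
    (g : O.Dart → O.Gamma p)
    (hg : ∀ (a b : O.Dart) (f : (O.toPolygonSurface.cut C).pt O.order a ⟶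
      (O.toPolygonSurface.cut C).pt O.order b), (O.toPolygonSurface.cut C).Conn O.order q a →
        O.inclusion C h ((O.toPolygonSurface.cut C).toLoop O.order q f) =
          g a * O.reglueLoop O.order p C f * (g b)⁻¹)
    (d : (O.cut C).Dart) (hd : (O.cut C).Conn (O.cut C).order q d) :
    sidePairing (O := O.cut C) (p := q) (ρ.comp (O.inclusion C h))
      (pullbackCocycle (O.inclusion C h) ρ u) (pullbackCocycle (O.inclusion C h) ρ v)
      (transport ρ u g X) (transport ρ v g Y) d =
    sidePairing (O := O) ρ u v X Y d := by
  have h1 : O.inclusion C h ((O.cut C).sideLoop (O.cut C).order q d) =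
      g d * O.sideLoop O.order p d * (g (O.next d))⁻¹ :=
    (hg _ _ ((O.cut C).side (O.cut C).order d) hd).trans
      (congrArg (fun z => g _ * z * (g _)⁻¹) (O.reglueLoop_side O.order p C d))
  have e1 := twist_pullbackCocycle (O.inclusion C h) ρ u X g h1
  have e2 := twist_pullbackCocycle (O.inclusion C h) ρ v Y g h1
  refine (congrArg₂ (fun a b => traceForm n a b) e1 e2).trans ?_
  exact traceForm_ad _ _ _

end Pieces

end ConeOrbifold

/-! ### Assembly of the additivity formula. -/

theorem affineAct_fixed_of_relCocycle {G I : Type} [Group G] {A : Rep.{0} ℝ G} {S : I → Subgroup G}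
    (x : relCocycles₁ A S) (i : I) (z : G) (hz : z ∈ S i) :
    affineAct (relCocycles₁.toCocycle A S x) z (x.1.2 i) = x.1.2 i := by
  have h : relCocycles₁.toCocycle A S x z = A.ρ z (x.1.2 i) - x.1.2 i := x.2.2 i z hz
  rw [affineAct_apply, h, sub_sub_cancel]

/-- A parabolic class relative to the curves is represented by a cocycle with a flat section. -/
theorem ConeOrbifold.CutSystem.exists_flat_of_mem_parH1 {O : ConeOrbifold} (hO : O.Connected)
    {p : O.Dart} {m : ℕ} (ξ : O.CutSystem m) {A : Rep.{0} ℝ (O.Gamma p)}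
    {u : groupCohomology.H1 A} (hu : u ∈ parH1 A (ξ.pair p)) :
    ∃ (w : groupCohomology.cocycles₁ A) (X : O.Dart → A), groupCohomology.H1π A w = u ∧
      IsFlat w X ∧
        ∀ d ∈ ξ.darts, X d = affineAct w (O.crossLoop O.order p d) (X (O.glue d)) := by
  obtain ⟨x, hx⟩ := exists_of_mem_parH1 A _ hu
  obtain ⟨X, hX, hX'⟩ := ξ.exists_flat (relCocycles₁.toCocycle A _ x) hO
    (fun z => ⟨x.1.2 (Sum.inl z), affineAct_fixed_of_relCocycle x (Sum.inl z) _
      (Subgroup.mem_zpowers _)⟩)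
    (fun i => ⟨x.1.2 (Sum.inr i), affineAct_fixed_of_relCocycle x (Sum.inr i) _
      (Subgroup.mem_zpowers _)⟩)
  exact ⟨_, X, hx, hX, hX'⟩

theorem theorem1p3
    (O : ConeOrbifold) (hO : O.Connected) (p : O.Dart) (hχ : O.eulerChar p < 0)
    {m : ℕ} (ξ : O.CutSystem m)
    {l : ℕ} (q : Fin l → (O.cut ξ.darts).Dart)
    (hq : ∀ d, ∃! i, (O.cut ξ.darts).Conn (O.cut ξ.darts).order (q i) d)
    (hχq : ∀ i, (O.cut ξ.darts).eulerChar (q i) < 0)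
    (h : ∀ i, O.pt O.order p ⟶ O.pt O.order (q i))
    {n : ℕ} (𝓑 : O.BoundaryComponent p → ConjClasses (PSL n))
    (ρ : O.Gamma p →* PSL n) (hρ : O.HomSB p 𝓑 ρ)
    (𝓑' : ∀ i, (O.cut ξ.darts).BoundaryComponent (q i) → ConjClasses (PSL n))
    (hρ' : ∀ i, (O.cut ξ.darts).HomSB (q i) (𝓑' i) (ρ.comp (O.inclusion ξ.darts (h i))))
    (u v : groupCohomology.H1 (adRep ρ))
    (hu : u ∈ parH1 (adRep ρ) (ξ.pair p)) (hv : v ∈ parH1 (adRep ρ) (ξ.pair p)) :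
    ∃ (hu' : ∀ i, pullbackH1 (O.inclusion ξ.darts (h i)) ρ u ∈
          parH1 (adRep (ρ.comp (O.inclusion ξ.darts (h i))))
            ((O.cut ξ.darts).boundarySubgroup (q i)))
      (hv' : ∀ i, pullbackH1 (O.inclusion ξ.darts (h i)) ρ v ∈
          parH1 (adRep (ρ.comp (O.inclusion ξ.darts (h i))))
            ((O.cut ξ.darts).boundarySubgroup (q i))),
      ConeOrbifold.omegaABG ρ ⟨u, ξ.parH1_le p _ hu⟩ ⟨v, ξ.parH1_le p _ hv⟩ =
        ∑ i, ConeOrbifold.omegaABG (ρ.comp (O.inclusion ξ.darts (h i)))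
          ⟨pullbackH1 (O.inclusion ξ.darts (h i)) ρ u, hu' i⟩
          ⟨pullbackH1 (O.inclusion ξ.darts (h i)) ρ v, hv' i⟩ := by
  classical
  obtain ⟨w, X, rfl, hX, hXξ⟩ := ξ.exists_flat_of_mem_parH1 hO hu
  obtain ⟨z, Y, rfl, hY, hYξ⟩ := ξ.exists_flat_of_mem_parH1 hO hv
  -- The same sections are flat for the cut surface, hence usable on every piece.
  have hX' := hX.cut hXξ
  have hY' := hY.cut hYξ
  choose g hg using fun i => O.toPolygonSurface.exists_inclusion_toLoop O.order p ξ.darts (h i)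
  have hmem : ∀ (w : groupCohomology.cocycles₁ (adRep ρ)) (X : O.Dart → slAlg n)
      (_ : ∀ d, X d = affineAct w (O.cutTurnLoop O.order p ξ.darts d)
        (X ((O.toPolygonSurface.cut ξ.darts).rot d))) (i : Fin l),
      pullbackH1 (O.inclusion ξ.darts (h i)) ρ (groupCohomology.H1π (adRep ρ) w) ∈
        parH1 (adRep (ρ.comp (O.inclusion ξ.darts (h i))))
          ((O.cut ξ.darts).boundarySubgroup (q i)) := by
    intro w X hX i
    rw [ConeOrbifold.pullbackH1_H1π]
    obtain ⟨x, hx, -⟩ := ConeOrbifold.exists_relCocycle_of_flat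
      (O := O.cut ξ.darts) (p := q i)
      (ConeOrbifold.pullbackCocycle (O.inclusion ξ.darts (h i)) ρ w)
      (ConeOrbifold.transport ρ w (g i) X)
      (ConeOrbifold.isFlat_pullbackCocycle ρ (h i) w X hX (g i) (hg i))
    rw [← hx]
    exact mem_parH1 _ _ x
  refine ⟨hmem w X hX', hmem z Y hY', ?_⟩
  rw [ConeOrbifold.omegaABG_eq_sum_faces ρ w z X Y (fun d _ => hX d) (fun d _ => hY d) _ _ rfl rfl,
    Finset.filter_true_of_mem fun f _ => hO p _, Finset.filter_true_of_mem fun d _ => hO p d]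
  have hpiece := fun i => ConeOrbifold.omegaABG_eq_sum_faces
    (O := O.cut ξ.darts) (p := q i) (ρ.comp (O.inclusion ξ.darts (h i)))
    (ConeOrbifold.pullbackCocycle (O.inclusion ξ.darts (h i)) ρ w)
    (ConeOrbifold.pullbackCocycle (O.inclusion ξ.darts (h i)) ρ z)
    (ConeOrbifold.transport ρ w (g i) X) (ConeOrbifold.transport ρ z (g i) Y)
    (ConeOrbifold.isFlat_pullbackCocycle ρ (h i) w X hX' (g i) (hg i))
    (ConeOrbifold.isFlat_pullbackCocycle ρ (h i) z Y hY' (g i) (hg i))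
    ⟨_, hmem w X hX' i⟩ ⟨_, hmem z Y hY' i⟩
    (ConeOrbifold.pullbackH1_H1π _ ρ w).symm (ConeOrbifold.pullbackH1_H1π _ ρ z).symm
  rw [Finset.sum_congr rfl fun i _ => hpiece i, Finset.sum_add_distrib, ← Finset.mul_sum]
  refine congrArg₂ (· + ·) ?_ (congrArg _ ?_)
  · refine Eq.trans ?_ (Finset.sum_congr rfl fun i _ => Finset.sum_congr rfl fun f hf =>
      (ConeOrbifold.facePairing_pullbackCocycle ρ (h i) w z X Y (g i) (hg i) f
        (Finset.mem_filter.1 hf).2).symm)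
    -- The cut surface has the same polygons as the original, and each lies in exactly one piece.
    exact (sum_sum_filter_of_existsUnique
      (fun i (f : (O.cut ξ.darts).Face) => (O.cut ξ.darts).Conn (O.cut ξ.darts).order (q i) f.dart)
      (fun f => hq f.dart) (fun f => ConeOrbifold.facePairing (O := O) ρ w z X Y f)).symm
  · refine Eq.trans ?_ (Finset.sum_congr rfl fun i _ => Finset.sum_congr rfl fun d hd =>
      (ConeOrbifold.sidePairing_pullbackCocycle ρ (h i) w z X Y (g i) (hg i) d
        (Finset.mem_filter.1 hd).2).symm)
    exact (sum_sum_filter_of_existsUnique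
      (fun i d => (O.cut ξ.darts).Conn (O.cut ξ.darts).order (q i) d)
      hq (fun d => ConeOrbifold.sidePairing (O := O) ρ w z X Y d)).symm
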